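/- Let $n, d \ge 0$ be integers and let $\lambda = (\lambda_1 \ge \lambda_2 \ge \cdots)$ be a partition of $n$. Let $V_\lambda$ be the irreducible complex representation of the symmetric group $S_n$ indexed by $\lambda$, that is, the Specht module: the span of the polytabloids $e_t = \sum_{\pi \in C_t} \operatorname{sgn}(\pi)\, \pi\{t\}$, for $t$ a Young tableau of shape $\lambda$ with entries $1,\dots,n$, tabloid $\{t\}$ and column stabilizer $C_t$, inside the complex permutation representation on the tabloids of shape $\lambda$. Let $S_n$ act on the space $\mathbb{C}[x_1,\dots,x_n]_d$ of homogeneous polynomials of degree $d$ by permuting the variables. Number the boxes of the Young diagram of $\lambda$ from $1$ to $n$ in any order, let $h_i$ be the hook length of the $i$-th box, and put $n(\lambda) = \sum_{i \ge 1} (i-1)\lambda_i$. Then $V_\lambda$ is irreducible, and its multiplicity in $\mathbb{C}[x_1,\dots,x_n]_d$ (the number of summands isomorphic to $V_\lambda$ in any decomposition into a direct sum of irreducible subrepresentations; such decompositions exist) equals the number of solutions $y \in \mathbb{N}^n$, where $\mathbb{N} = \{0,1,2,\dots\}$, of the equation $$h_1 y_1 + \cdots + h_n y_n = d - n(\lambda).$$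 -/

import Mathlib

namespace SymMult

open Equiv

/-! ### Multiplicities in a direct sum of irreducible representations -/

section Multiplicity

variable {G V W : Type*} [Group G] [AddCommGroup V] [Module ℂ V] [AddCommGroup W] [Module ℂ W]

/-- `V` is the internal direct sum of the irreducible subrepresentations `U 0, …, U (k - 1)`. -/
structure IsIrreducibleDecomposition (ρ : Representation ℂ G V) {k : ℕ}
    (U : Fin k → Subrepresentation ρ) : Prop where
  isInternal : DirectSum.IsInternal fun i => (U i).toSubmodule
  isIrreducible : ∀ i, (U i).toRepresentation.IsIrreducible

/-- The representation `σ` occurs in `ρ` with multiplicity `m`: the representation `ρ` is a finite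
direct sum of irreducible subrepresentations, and in every such decomposition exactly `m` of the
summands are isomorphic to `σ`. -/
def HasMultiplicity (ρ : Representation ℂ G V) (σ : Representation ℂ G W) (m : ℕ) : Prop :=
  (∃ (k : ℕ) (U : Fin k → Subrepresentation ρ), IsIrreducibleDecomposition ρ U) ∧
  ∀ (k : ℕ) (U : Fin k → Subrepresentation ρ), IsIrreducibleDecomposition ρ U →
    Nat.card {i : Fin k // Nonempty ((U i).toRepresentation.Equiv σ)} = m

end Multiplicity

/-! ### The symmetric group acting on homogeneous polynomials -/

/-- `S_n` acting on `ℂ[x_1, …, x_n]` by permuting the variables, `g • x_i = x_{g i}`. -/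
noncomputable def polyRep (n : ℕ) :
    Representation ℂ (Perm (Fin n)) (MvPolynomial (Fin n) ℂ) where
  toFun g := (MvPolynomial.rename g).toLinearMap
  map_one' := by
    refine LinearMap.ext fun p => ?_
    simp
  map_mul' g h := by
    refine LinearMap.ext fun p => ?_
    simp [MvPolynomial.rename_rename]

/-- The homogeneous polynomials of degree `d` (with zero), stable under permuting variables. -/
noncomputable def homogeneousSubrep (n d : ℕ) : Subrepresentation (polyRep n) where
  toSubmodule := MvPolynomial.homogeneousSubmodule (Fin n) ℂ d
  apply_mem_toSubmodule _ _ hp := MvPolynomial.IsHomogeneous.rename_isHomogeneous hp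

/-- `S_n` acting on `ℂ[x_1, …, x_n]_d`. -/
noncomputable def homogeneousRep (n d : ℕ) :
    Representation ℂ (Perm (Fin n)) (homogeneousSubrep n d).toSubmodule :=
  (homogeneousSubrep n d).toRepresentation

/-! ### Hook lengths and `n(λ)` -/

/-- The hook length of the box `c = (i, j)` of `μ` (row `i`, column `j`, counted from `0`):
arm length plus leg length plus one. -/
def hookLength (μ : YoungDiagram) (c : ℕ × ℕ) : ℕ :=
  (μ.rowLen c.1 - c.2 - 1) + (μ.colLen c.2 - c.1 - 1) + 1

/-- `n(λ) = ∑ (i - 1) λ_i`; rows are counted from `0` here. -/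
def nStat (μ : YoungDiagram) : ℕ :=
  ∑ i ∈ Finset.range (μ.colLen 0), i * μ.rowLen i

/-! ### Specht modules -/

/-- A Young tableau of shape `μ` with entries `Fin n`, each used once: `t i` is the box that
contains `i`. -/
abbrev Tableau (μ : YoungDiagram) (n : ℕ) : Type := Fin n ≃ μ.cells

/-- A tabloid of shape `μ` (a tableau up to permutations within the rows), given by the
function sending each entry to its row. -/
def Tabloid (μ : YoungDiagram) (n : ℕ) : Type :=
  {f : Fin n → ℕ // ∀ r, Nat.card {i // f i = r} = μ.rowLen r}

/-- `S_n` acts on tabloids by permuting the entries. -/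
instance (μ : YoungDiagram) (n : ℕ) : MulAction (Perm (Fin n)) (Tabloid μ n) where
  smul g T := ⟨fun i => T.1 (g⁻¹ i), fun r => by
    rw [← T.2 r]
    exact Nat.card_congr ((g⁻¹ : Perm (Fin n)).subtypeEquiv fun _ => Iff.rfl)⟩
  one_smul _ := rfl
  mul_smul g h T := Subtype.ext <| funext fun i => by
    change T.1 ((g * h)⁻¹ i) = T.1 (h⁻¹ (g⁻¹ i))
    rw [mul_inv_rev, Perm.mul_apply]

/-- The tabloid `{t}` of a tableau `t`. -/
def Tableau.tabloid {μ : YoungDiagram} {n : ℕ} (t : Tableau μ n) : Tabloid μ n :=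
  ⟨fun i => (t i).1.1, fun r => by
    rw [YoungDiagram.rowLen_eq_card, ← Nat.card_eq_finsetCard]
    refine Nat.card_congr ((t.subtypeEquiv (q := fun c => c.1.1 = r) fun _ => Iff.rfl).trans
      ⟨fun c => ⟨c.1.1, YoungDiagram.mem_row_iff.2 ⟨c.1.2, c.2⟩⟩,
        fun c => ⟨⟨c.1, (YoungDiagram.mem_row_iff.1 c.2).1⟩, (YoungDiagram.mem_row_iff.1 c.2).2⟩,
        fun _ => rfl, fun _ => rfl⟩)⟩

/-- The column stabilizer of `t`: the permutations that keep every entry in its column of `t`. -/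
def Tableau.colStabilizer {μ : YoungDiagram} {n : ℕ} (t : Tableau μ n) :
    Finset (Perm (Fin n)) :=
  Finset.univ.filter fun π => ∀ i, (t (π i)).1.2 = (t i).1.2

/-- The polytabloid `e_t = ∑ sgn(π) π{t}`, the sum over the column stabilizer of `t`, in the
complex vector space with basis the tabloids. -/
noncomputable def Tableau.polytabloid {μ : YoungDiagram} {n : ℕ} (t : Tableau μ n) :
    MonoidAlgebra ℂ (Tabloid μ n) :=
  ∑ π ∈ t.colStabilizer, MonoidAlgebra.single (π • t.tabloid) ((Perm.sign π : ℤ) : ℂ)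

/-- Permuting the entries of a tableau permutes polytabloids: `g e_t = e_{gt}`. -/
theorem ofMulAction_polytabloid {μ : YoungDiagram} {n : ℕ} (g : Perm (Fin n))
    (t : Tableau μ n) :
    Representation.ofMulAction ℂ (Perm (Fin n)) (Tabloid μ n) g t.polytabloid =
      Tableau.polytabloid ((g⁻¹ : Perm (Fin n)).trans t : Tableau μ n) := by
  unfold Tableau.polytabloid
  rw [map_sum]
  refine Finset.sum_bij' (fun π _ => g * π * g⁻¹) (fun π _ => g⁻¹ * π * g) ?_ ?_ ?_ ?_ ?_
  · intro π hπ
    simp only [Tableau.colStabilizer, Finset.mem_filter, Finset.mem_univ, true_and] at hπ ⊢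
    intro i
    simpa using hπ (g⁻¹ i)
  · intro π hπ
    simp only [Tableau.colStabilizer, Finset.mem_filter, Finset.mem_univ, true_and] at hπ ⊢
    intro i
    simpa using hπ (g i)
  · intro π _
    group
  · intro π _
    group
  · intro π _
    have h : Tableau.tabloid ((g⁻¹ : Perm (Fin n)).trans t : Tableau μ n) = g • t.tabloid := rfl
    rw [h, Representation.ofMulAction_single, smul_smul, smul_smul]
    congr 1
    · congr 1
      group
    · rw [Perm.sign_mul, Perm.sign_mul, Perm.sign_inv, mul_right_comm, Int.units_mul_self, one_mul]

/-- The subrepresentation spanned by the polytabloids of shape `μ` inside the permutation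
representation of `S_n` on tabloids. -/
noncomputable def spechtSubrep (μ : YoungDiagram) (n : ℕ) :
    Subrepresentation (Representation.ofMulAction ℂ (Perm (Fin n)) (Tabloid μ n)) where
  toSubmodule := Submodule.span ℂ (Set.range Tableau.polytabloid)
  apply_mem_toSubmodule g v hv := by
    induction hv using Submodule.span_induction with
    | mem x hx =>
      obtain ⟨t, rfl⟩ := hx
      rw [ofMulAction_polytabloid]
      exact Submodule.subset_span ⟨_, rfl⟩
    | zero => rw [map_zero]; exact Submodule.zero_mem _
    | add x y _ _ hx hy => rw [map_add]; exact Submodule.add_mem _ hx hy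
    | smul a x _ hx => rw [map_smul]; exact Submodule.smul_mem _ a hx

/-- The Specht module `V_λ`, for `μ` the Young diagram of a partition `λ` of `n`. -/
noncomputable def spechtRep (μ : YoungDiagram) (n : ℕ) :
    Representation ℂ (Perm (Fin n)) (spechtSubrep μ n).toSubmodule :=
  (spechtSubrep μ n).toRepresentation

end SymMult

namespace SymMult

open Equiv

/-! ### Multiplicities from characters. -/

section Multiplicity

variable {G V W : Type*} [Group G] [AddCommGroup V] [Module ℂ V] [AddCommGroup W] [Module ℂ W]

/-! By orthonormality of irreducible characters, the multiplicity is the inner product of the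
characters of ℂ[x]_d and V_λ (`hasMultiplicity_of_character`). It is computed from Frobenius'
formula for the character of V_λ.

Let δ = (N-1, …, 0), l = λ + δ, let a_e be the alternant with exponents e, and let p_g be the
product of power sums over the cycles of g, realised as the sum over words fixed by g
(`fixedWordSum`). Let χ(g) be the coefficient of x^l in a_δ p_g. Cauchy's determinant and Σ_g p_g(x)
p_g(y) = n! h_n(x_i y_j) give a_δ(y) Σ_g χ(g) p_g(y) = n! a_l(y)
(`alternant_mul_sum_frobeniusChar`). Reading off the coefficient of y^l shows that χ has norm 1.

Moreover χ is a signed sum over w of the permutation characters on words of content l - δ∘w. James'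
column antisymmetrizer argument shows that V_λ is irreducible, that it maps into the term w = 1, the
tabloid module, in one way up to scalar, and that it does not map into the other terms. So χ and the
character of V_λ both have norm 1 and have inner product 1; hence they agree
(`character_spechtRep`).

Finally put y_j = q^j for 0 ≤ j < N. For N > d the coefficient of q^d in p_g counts the monomials of
degree d fixed by g, which is the character of ℂ[x]_d. The quotient a_l / a_δ becomes a quotient of
Vandermonde products, equal to q^{n(λ)} ∏ (1 - q^{N + c}) / ∏ (1 - q^h) over the boxes, with c the
content and h the hook length. For N large the numerator is 1 modulo q^{d+1}, and 1 / ∏ (1 -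
q^{h_i}) generates the solutions counted (`coeff_eq_ncard`). -/

theorem isIrreducible_of_isAtom {ρ : Representation ℂ G V} {U : Subrepresentation ρ}
    (hU : IsAtom U) : U.toRepresentation.IsIrreducible := by
  have hne : (⊥ : Subrepresentation U.toRepresentation) ≠ ⊤ := fun h => hU.1 <| by
    refine Subrepresentation.toSubmodule_injective ((Submodule.eq_bot_iff _).2 fun v hv => ?_)
    have hmem : (⟨v, hv⟩ : U.toSubmodule) ∈ (⊤ : Subrepresentation U.toRepresentation).toSubmodule :=
      Submodule.mem_top
    rw [← h] at hmem
    exact congrArg Subtype.val ((Submodule.mem_bot ℂ).1 hmem)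
  refine { exists_pair_ne := ⟨_, _, hne⟩, eq_bot_or_eq_top := fun T => ?_ }
  let T' : Subrepresentation ρ :=
    { toSubmodule := T.toSubmodule.map U.toSubmodule.subtype
      apply_mem_toSubmodule := by
        rintro g _ ⟨v, hv, rfl⟩
        exact ⟨_, T.apply_mem_toSubmodule g hv, rfl⟩ }
  have hle : T' ≤ U := by
    rintro _ ⟨v, -, rfl⟩
    exact v.2
  refine (hU.le_iff.1 hle).imp (fun h => ?_) fun h => ?_
  · refine Subrepresentation.toSubmodule_injective ((Submodule.eq_bot_iff _).2 fun v hv => ?_)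
    have hmem : (v : V) ∈ T'.toSubmodule := ⟨v, hv, rfl⟩
    rw [h] at hmem
    exact Subtype.ext ((Submodule.mem_bot ℂ).1 hmem)
  · refine Subrepresentation.toSubmodule_injective ((Submodule.eq_top_iff').2 fun v => ?_)
    have hmem : (v : V) ∈ T'.toSubmodule := by rw [h]; exact v.2
    obtain ⟨w, hw, hwv⟩ := hmem
    rwa [← Subtype.ext hwv]

/-- Maschke's theorem gives an independent family of simple submodules over the group algebra; it is
finite because the module is Noetherian. -/
theorem exists_isIrreducibleDecomposition [Finite G] [FiniteDimensional ℂ V]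
    (ρ : Representation ℂ G V) :
    ∃ (k : ℕ) (U : Fin k → Subrepresentation ρ), IsIrreducibleDecomposition ρ U := by
  have : NeZero (Nat.card G : ℂ) := ⟨by exact_mod_cast Nat.card_pos.ne'⟩
  obtain ⟨s, hs, htop, hsimple⟩ :=
    IsSemisimpleModule.exists_sSupIndep_sSup_simples_eq_top (MonoidAlgebra ℂ G) ρ.asModule
  have : FiniteDimensional ℂ ρ.asModule := inferInstanceAs (FiniteDimensional ℂ V)
  have : IsNoetherian (MonoidAlgebra ℂ G) ρ.asModule :=
    isNoetherian_of_tower ℂ inferInstance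
  have hfin : s.Finite := WellFoundedGT.finite_of_sSupIndep hs
  have := hfin.to_subtype
  obtain ⟨k, ⟨e⟩⟩ := Finite.exists_equiv_fin s
  refine ⟨k, fun i => Subrepresentation.ofSubmodule' (e.symm i).1, ?_, fun i => ?_⟩
  · have h : DirectSum.IsInternal fun i => (e.symm i).1 := by
      refine DirectSum.isInternal_submodule_of_iSupIndep_of_iSup_eq_top ?_ ?_
      · exact ((sSupIndep_iff s).1 hs).comp e.symm.injective
      · rw [← htop, sSup_eq_iSup']
        exact e.symm.iSup_comp (g := fun a : s => a.1)
    exact h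
  · have h := isSimpleModule_iff_isAtom.1 (hsimple _ (e.symm i).2)
    exact isIrreducible_of_isAtom <|
      (Subrepresentation.subrepresentationSubmoduleOrderIso.symm.isAtom_iff _).2 h

theorem character_eq_sum_of_isInternal [FiniteDimensional ℂ V] {ρ : Representation ℂ G V}
    {k : ℕ} {U : Fin k → Subrepresentation ρ}
    (hU : DirectSum.IsInternal fun i => (U i).toSubmodule) (g : G) :
    ρ.character g = ∑ i, (U i).toRepresentation.character g :=
  LinearMap.trace_eq_sum_trace_restrict hU fun i _ hv => (U i).apply_mem_toSubmodule g hv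

/-- The character is additive over a decomposition, and by orthonormality each summand contributes 1
or 0 to the inner product according to whether it is isomorphic to `σ`. -/
theorem hasMultiplicity_of_character [Fintype G] [FiniteDimensional ℂ V] [FiniteDimensional ℂ W]
    {ρ : Representation ℂ G V} {σ : Representation ℂ G W} [σ.IsIrreducible] {m : ℕ}
    (h : ∑ g, ρ.character g * σ.character g⁻¹ = Fintype.card G * m) :
    HasMultiplicity ρ σ m := by
  refine ⟨exists_isIrreducibleDecomposition ρ, fun k U hU => ?_⟩
  classical
  have hG : (Nat.card G : ℂ) ≠ 0 := by exact_mod_cast Nat.card_pos.ne'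
  have : Invertible (Nat.card G : ℂ) := invertibleOfNonzero hG
  have key : ∀ i, ∑ g, (U i).toRepresentation.character g * σ.character g⁻¹ =
      Nat.card G * if Nonempty ((U i).toRepresentation.Equiv σ) then 1 else 0 := by
    intro i
    have := hU.isIrreducible i
    have h := Representation.char_orthonormal (U i).toRepresentation σ
    rw [inv_mul_eq_iff_eq_mul₀ hG] at h
    rw [h]
    congr 2
    exact propext ⟨fun ⟨e⟩ => ⟨e.symm⟩, fun ⟨e⟩ => ⟨e.symm⟩⟩
  simp_rw [character_eq_sum_of_isInternal hU.isInternal, Finset.sum_mul] at h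
  rw [Finset.sum_comm, Finset.sum_congr rfl fun i _ => key i, ← Finset.mul_sum,
    ← Nat.card_eq_fintype_card] at h
  have h' := mul_left_cancel₀ hG h
  rw [Finset.sum_boole] at h'
  rw [Nat.card_eq_fintype_card, Fintype.card_subtype]
  exact_mod_cast h'

/-- Since `ρ g` has finite order it is diagonalizable and its eigenvalues are roots of unity, whose
inverses are their conjugates. -/
theorem character_inv_eq_conj [Finite G] [FiniteDimensional ℂ V] (ρ : Representation ℂ G V)
    (g : G) : ρ.character g⁻¹ = starRingEnd ℂ (ρ.character g) := by
  have hpow : ρ g ^ orderOf g = 1 := by rw [← map_pow, pow_orderOf_eq_one, map_one]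
  have hss : Module.End.IsSemisimple (ρ g) := by
    refine Module.End.isSemisimple_of_squarefree_aeval_eq_zero
      (p := Polynomial.X ^ orderOf g - Polynomial.C 1) ?_ (by simp [hpow])
    refine (Polynomial.separable_X_pow_sub_C (1 : ℂ) ?_ one_ne_zero).squarefree
    exact_mod_cast (orderOf_pos g).ne'
  have hint : DirectSum.IsInternal (Module.End.eigenspace (ρ g)) :=
    DirectSum.isInternal_submodule_of_iSupIndep_of_iSup_eq_top
      (Module.End.eigenspaces_iSupIndep _) hss.iSup_eigenspace_eq_top
  have hfin : {c | Module.End.eigenspace (ρ g) c ≠ ⊥}.Finite :=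
    WellFoundedGT.finite_ne_bot_of_iSupIndep (Module.End.eigenspaces_iSupIndep _)
  have hinv : ∀ c v, v ∈ Module.End.eigenspace (ρ g) c → ρ g⁻¹ v = c⁻¹ • v := by
    intro c v hv
    rw [Module.End.mem_eigenspace_iff] at hv
    have h : v = c • ρ g⁻¹ v := by
      rw [← map_smul, ← hv, ← Module.End.mul_apply, ← map_mul, inv_mul_cancel, map_one,
        Module.End.one_apply]
    -- For `c = 0` the vector is zero, so the convention `0⁻¹ = 0` does no harm.
    rcases eq_or_ne c 0 with rfl | hc
    · rw [zero_smul] at h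
      simp [h]
    · conv_rhs => rw [h, smul_smul, inv_mul_cancel₀ hc, one_smul]
  have hmaps : ∀ c, Set.MapsTo (ρ g) (Module.End.eigenspace (ρ g) c)
      (Module.End.eigenspace (ρ g) c) := fun c v hv => by
    have h := Module.End.mem_eigenspace_iff.1 hv
    rw [h]
    exact Submodule.smul_mem _ _ hv
  have hmaps' : ∀ c, Set.MapsTo (ρ g⁻¹) (Module.End.eigenspace (ρ g) c)
      (Module.End.eigenspace (ρ g) c) := fun c v hv => by
    rw [hinv c v hv]
    exact Submodule.smul_mem _ _ hv
  unfold Representation.character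
  rw [LinearMap.trace_eq_sum_trace_restrict' hint hfin hmaps,
    LinearMap.trace_eq_sum_trace_restrict' hint hfin hmaps', map_sum]
  refine Finset.sum_congr rfl fun c hc => ?_
  have h1 : (ρ g).restrict (hmaps c) = c • LinearMap.id := by
    ext v
    exact Module.End.mem_eigenspace_iff.1 v.2
  have h2 : (ρ g⁻¹).restrict (hmaps' c) = c⁻¹ • LinearMap.id := by
    ext v
    exact hinv c v v.2
  have hc1 : c ^ orderOf g = 1 := by
    obtain ⟨v, hv, hv0⟩ := (Submodule.ne_bot_iff _).1 (hfin.mem_toFinset.1 hc)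
    have h : (ρ g ^ orderOf g) v = c ^ orderOf g • v :=
      Module.End.HasEigenvector.pow_apply ⟨hv, hv0⟩ _
    rw [hpow, Module.End.one_apply] at h
    by_contra hne
    have h0 : (c ^ orderOf g - 1) • v = 0 := by rw [sub_smul, ← h, one_smul, sub_self]
    exact hv0 ((smul_eq_zero.1 h0).resolve_left (sub_ne_zero.2 hne))
  rw [h1, h2, map_smul, map_smul, smul_eq_mul, smul_eq_mul, map_mul, LinearMap.trace_id, map_natCast,
    Complex.inv_eq_conj (Complex.norm_eq_one_of_pow_eq_one hc1 (orderOf_pos g).ne')]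

end Multiplicity

/-! ### Characters of permutation representations and of homogeneous polynomials. -/

section PermutationRepresentations

variable {G X : Type*} [Group G] [MulAction G X] [Finite X]

instance : FiniteDimensional ℂ (MonoidAlgebra ℂ X) :=
  Module.Finite.equiv (MonoidAlgebra.coeffLinearEquiv ℂ).symm

/-- A permutation of a basis has trace the number of fixed basis vectors. -/
theorem trace_eq_card_fixed {V X : Type*} [AddCommGroup V] [Module ℂ V] [Finite X]
    (b : Module.Basis X ℂ V) (f : V →ₗ[ℂ] V) (p : X → X) (hf : ∀ x, f (b x) = b (p x)) :
    LinearMap.trace ℂ V f = Nat.card {x // p x = x} := by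
  classical
  have := Fintype.ofFinite X
  rw [LinearMap.trace_eq_matrix_trace ℂ b, Matrix.trace, Nat.card_eq_fintype_card,
    Fintype.card_subtype, ← Finset.sum_boole]
  refine Finset.sum_congr rfl fun x _ => ?_
  rw [Matrix.diag_apply, LinearMap.toMatrix_apply, hf, b.repr_self, Finsupp.single_apply]

theorem character_ofMulAction (g : G) :
    (Representation.ofMulAction ℂ G X).character g = Nat.card {x : X // g • x = x} :=
  trace_eq_card_fixed ⟨MonoidAlgebra.coeffLinearEquiv ℂ⟩ _ _ fun x =>
    Representation.ofMulAction_single g x 1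

end PermutationRepresentations

instance (n d : ℕ) : FiniteDimensional ℂ (homogeneousSubrep n d).toSubmodule :=
  Module.Finite.iff_fg.2 (MvPolynomial.homogeneousSubmodule_fg _ _ d)

/-- The monomials of degree `d` as a basis of the homogeneous polynomials of degree `d`. -/
noncomputable def homogeneousBasis (n d : ℕ) :
    Module.Basis {a : Fin n →₀ ℕ // a.degree = d} ℂ (homogeneousSubrep n d).toSubmodule :=
  Module.Basis.mk
    (v := fun a => ⟨MvPolynomial.monomial a.1 1, MvPolynomial.isHomogeneous_monomial 1 a.2⟩)
    (LinearIndependent.of_comp (Submodule.subtype _)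
      ((MvPolynomial.basisMonomials (Fin n) ℂ).linearIndependent.comp _ Subtype.val_injective))
    (by
      rintro ⟨p, hp⟩ -
      have hdeg : ∀ a ∈ p.support, a.degree = d := fun a ha => by
        rw [Finsupp.degree_eq_weight_one]
        exact hp (MvPolynomial.mem_support_iff.1 ha)
      have hsum : (⟨p, hp⟩ : (homogeneousSubrep n d).toSubmodule) =
          ∑ a ∈ p.support.attach, p.coeff a.1 • ⟨MvPolynomial.monomial a.1 1,
            MvPolynomial.isHomogeneous_monomial 1 (hdeg a.1 a.2)⟩ := by
        refine Subtype.ext ?_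
        rw [AddSubmonoidClass.coe_finsetSum]
        refine p.as_sum.trans ?_
        rw [← Finset.sum_attach]
        refine Finset.sum_congr rfl fun a _ => ?_
        rw [Submodule.coe_smul, MvPolynomial.smul_monomial, smul_eq_mul, mul_one]
      rw [hsum]
      exact Submodule.sum_mem _ fun a _ => Submodule.smul_mem _ _
        (Submodule.subset_span ⟨⟨a.1, hdeg a.1 a.2⟩, rfl⟩))

theorem character_homogeneousRep (n d : ℕ) (g : Perm (Fin n)) :
    (homogeneousRep n d).character g =
      Nat.card {a : Fin n → ℕ // ∑ i, a i = d ∧ a ∘ g = a} := by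
  have : Finite {a : Fin n →₀ ℕ // a.degree = d} :=
    Module.Finite.finite_basis (homogeneousBasis n d)
  have hmap : ∀ (a : Fin n →₀ ℕ) i, a.mapDomain g i = a (g⁻¹ i) := fun a i => by
    obtain ⟨j, rfl⟩ := g.surjective i
    rw [Finsupp.mapDomain_apply g.injective, Perm.inv_def, Equiv.symm_apply_apply]
  have hdeg : ∀ a : Fin n →₀ ℕ, (a.mapDomain g).degree = a.degree := fun a => by
    simp_rw [Finsupp.degree_eq_sum, hmap]
    exact Equiv.sum_comp g⁻¹ a
  have h := trace_eq_card_fixed (homogeneousBasis n d) (homogeneousRep n d g)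
    (fun a => ⟨a.1.mapDomain g, by rw [hdeg, a.2]⟩) fun a => by
      refine Subtype.ext ?_
      rw [homogeneousBasis, Module.Basis.mk_apply, Module.Basis.mk_apply]
      exact MvPolynomial.rename_monomial _ _ _
  refine h.trans (congrArg _ (Nat.card_congr ?_))
  have hfix : ∀ a : Fin n →₀ ℕ, a.mapDomain g = a ↔ ⇑a ∘ g = a := fun a => by
    rw [DFunLike.ext_iff, funext_iff, ← g.forall_congr_right]
    simp only [hmap, Perm.inv_def, Equiv.symm_apply_apply, Function.comp_apply]
    exact forall_congr' fun _ => eq_comm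
  exact
    { toFun := fun a => ⟨a.1.1, by rw [← Finsupp.degree_eq_sum, a.1.2],
        (hfix _).1 (congrArg Subtype.val a.2)⟩
      invFun := fun a => ⟨⟨Finsupp.equivFunOnFinite.symm a.1, by
        rw [Finsupp.degree_eq_sum]; exact a.2.1⟩, Subtype.ext ((hfix _).2 a.2.2)⟩
      left_inv := fun a => Subtype.ext (Subtype.ext (Finsupp.ext fun _ => rfl))
      right_inv := fun a => rfl }

theorem prod_X_pow {R σ : Type*} [CommRing R] [Fintype σ] (c : σ →₀ ℕ) :
    ∏ a, (MvPolynomial.X a : MvPolynomial σ R) ^ c a = MvPolynomial.monomial c 1 := by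
  rw [MvPolynomial.monomial_eq, map_one, one_mul, Finsupp.prod_fintype _ _ fun _ => pow_zero _]

theorem coeff_intCast_mul {R σ : Type*} [CommRing R] (k : ℤ) (c : σ →₀ ℕ) (p : MvPolynomial σ R) :
    MvPolynomial.coeff c ((k : MvPolynomial σ R) * p) = k * MvPolynomial.coeff c p := by
  rw [← MvPolynomial.coeff_C_mul, map_intCast]

/-! ### Words fixed by a permutation, and complete symmetric polynomials. -/

section Words

variable {R σ : Type*} [CommRing R] [Fintype σ] [DecidableEq σ] {n : ℕ}

/-- The number of occurrences of each letter in a word. -/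
noncomputable def content (f : Fin n → σ) : σ →₀ ℕ :=
  Finsupp.equivFunOnFinite.symm fun a => Fintype.card {i // f i = a}

theorem content_apply (f : Fin n → σ) (a : σ) : content f a = Fintype.card {i // f i = a} := rfl

theorem prod_apply_eq_prod_pow_content (f : Fin n → σ) (z : σ → R) :
    ∏ i, z (f i) = ∏ a, z a ^ content f a := by
  rw [← Finset.prod_fiberwise' Finset.univ f z]
  refine Finset.prod_congr rfl fun a _ => ?_
  rw [Finset.prod_const, content_apply, Fintype.card_subtype]

theorem sum_content (f : Fin n → σ) : ∑ a, content f a = n := by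
  simp_rw [content_apply, Fintype.card_subtype]
  rw [← Finset.card_eq_sum_card_fiberwise fun _ _ => Finset.mem_univ _]
  simp

theorem monomial_content (f : Fin n → σ) :
    MvPolynomial.monomial (content f) (1 : R) = ∏ i, MvPolynomial.X (f i) := by
  rw [prod_apply_eq_prod_pow_content f MvPolynomial.X, prod_X_pow]

/-- The number of words with a given content is a multinomial coefficient. -/
theorem card_words_mul_prod_factorial (c : σ →₀ ℕ) (hc : ∑ a, c a = n) :
    (Finset.univ.filter fun f : Fin n → σ => content f = c).card * ∏ a, (c a).factorial =
      n.factorial := by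
  -- The power of the sum of the variables is expanded twice: as a sum over words here, and by the
  -- multinomial theorem in `h'`.
  have h : (∑ a, MvPolynomial.X a : MvPolynomial σ ℤ) ^ n =
      ∑ f : Fin n → σ, MvPolynomial.monomial (content f) 1 := by
    simp_rw [monomial_content]
    rw [← Fintype.piFinset_univ, ← Finset.prod_univ_sum (fun _ => Finset.univ)
      (fun (_ : Fin n) a => MvPolynomial.X a), Finset.prod_const, Finset.card_univ, Fintype.card_fin]
  have h' : MvPolynomial.coeff c ((∑ a, MvPolynomial.X a : MvPolynomial σ ℤ) ^ n) =
      Nat.multinomial Finset.univ c := by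
    have hmon : ∀ k : σ → ℕ, MvPolynomial.coeff c ((Nat.multinomial Finset.univ k : MvPolynomial σ ℤ) *
        ∏ a, (MvPolynomial.X a : MvPolynomial σ ℤ) ^ k a) =
        if k = ⇑c then (Nat.multinomial Finset.univ k : ℤ) else 0 := fun k => by
      obtain ⟨k, rfl⟩ := Finsupp.equivFunOnFinite.surjective k
      rw [show Finsupp.equivFunOnFinite k = ⇑k from rfl, prod_X_pow, ← map_natCast (MvPolynomial.C (σ := σ)),
        MvPolynomial.coeff_C_mul, MvPolynomial.coeff_monomial]
      simp [DFunLike.coe_fn_eq]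
    rw [Finset.sum_pow_eq_sum_piAntidiag, MvPolynomial.coeff_sum, Finset.sum_eq_single ⇑c]
    · rw [hmon, if_pos rfl]
    · intro k _ hk
      rw [hmon, if_neg hk]
    · intro hk
      exact absurd (Finset.mem_piAntidiag.2 ⟨hc, fun _ _ => Finset.mem_univ _⟩) hk
  rw [h, MvPolynomial.coeff_sum] at h'
  simp_rw [MvPolynomial.coeff_monomial] at h'
  rw [Finset.sum_boole] at h'
  have h'' : (Finset.univ.filter fun f : Fin n → σ => content f = c).card =
      Nat.multinomial Finset.univ c := by exact_mod_cast h'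
  rw [h'', mul_comm, Nat.multinomial_spec, hc]

/-- The sum of the monomials of the words fixed by the permutation `g`. -/
def fixedWordSum (g : Perm (Fin n)) (z : σ → R) : R :=
  ∑ f : Fin n → σ with f ∘ g = f, ∏ i, z (f i)

/-- The complete homogeneous symmetric polynomial of degree `n` in the `z a`. -/
def completeSum (n : ℕ) (z : σ → R) : R :=
  ∑ c ∈ Finset.univ.finsuppAntidiag n, ∏ a, z a ^ c a

/-- A word of content c is fixed by ∏ c_a! permutations, and there are n! / ∏ c_a! such words, so
each monomial of degree n occurs n! times. -/
theorem sum_fixedWordSum (z : σ → R) :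
    ∑ g : Perm (Fin n), fixedWordSum g z = n.factorial * completeSum n z := by
  have h1 : ∑ g : Perm (Fin n), fixedWordSum g z =
      ∑ f : Fin n → σ, (∏ a, ((content f a).factorial : R)) * ∏ a, z a ^ content f a := by
    simp_rw [fixedWordSum, Finset.sum_filter]
    rw [Finset.sum_comm]
    refine Finset.sum_congr rfl fun f _ => ?_
    rw [← Finset.sum_filter, Finset.sum_const, ← Fintype.card_subtype, DomMulAct.stabilizer_card,
      nsmul_eq_mul, prod_apply_eq_prod_pow_content, Nat.cast_prod]
    rfl
  rw [h1, ← Finset.sum_fiberwise_of_maps_to (g := content) (t := Finset.univ.finsuppAntidiag n)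
    fun f _ => by simp [Finset.mem_finsuppAntidiag, sum_content], completeSum, Finset.mul_sum]
  refine Finset.sum_congr rfl fun c hc => ?_
  have hc' : ∑ a, c a = n := (Finset.mem_finsuppAntidiag.1 hc).1
  rw [Finset.sum_congr rfl (g := fun _ => (∏ a, ((c a).factorial : R)) * ∏ a, z a ^ c a)
    fun f hf => by rw [(Finset.mem_filter.1 hf).2], Finset.sum_const, nsmul_eq_mul, ← mul_assoc,
    ← card_words_mul_prod_factorial c hc', Nat.cast_mul, Nat.cast_prod]

/-- A pair of words fixed by `g` is the same as a fixed word in the product alphabet. -/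
theorem fixedWordSum_mul {τ : Type*} [Fintype τ] [DecidableEq τ] (g : Perm (Fin n)) (x : σ → R)
    (y : τ → R) :
    fixedWordSum g x * fixedWordSum g y = fixedWordSum g fun p : σ × τ => x p.1 * y p.2 := by
  simp_rw [fixedWordSum]
  rw [Finset.sum_mul_sum, ← Finset.sum_product']
  refine Finset.sum_bij' (fun p _ i => (p.1 i, p.2 i)) (fun f _ => (fun i => (f i).1, fun i => (f i).2))
    ?_ ?_ ?_ ?_ ?_
  · simp only [Finset.mem_product, Finset.mem_filter, Finset.mem_univ, true_and, funext_iff,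
      Function.comp_apply, Prod.ext_iff]
    exact fun p hp i => ⟨hp.1 i, hp.2 i⟩
  · simp only [Finset.mem_product, Finset.mem_filter, Finset.mem_univ, true_and, funext_iff,
      Function.comp_apply, Prod.ext_iff]
    exact fun p hp => ⟨fun i => (hp i).1, fun i => (hp i).2⟩
  · exact fun _ _ => rfl
  · exact fun _ _ => rfl
  · exact fun p _ => Finset.prod_mul_distrib.symm

end Words

/-! ### Alternants and the Cauchy identity. -/

section Cauchy

variable {R : Type*} [CommRing R] {N : ℕ}

/-- The alternant `det (y_j ^ e_i)`. -/
def alternant (y : Fin N → R) (e : Fin N → ℕ) : R :=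
  Matrix.det (Matrix.of fun i j => y j ^ e i)

/-- The exponents `N - 1, …, 1, 0`. -/
def staircase (N : ℕ) (i : Fin N) : ℕ := (Fin.rev i : ℕ)

theorem alternant_eq_sum (y : Fin N → R) (e : Fin N → ℕ) :
    alternant y e = ∑ w : Perm (Fin N), ((Perm.sign w : ℤ) : R) * ∏ i, y i ^ e (w i) := by
  rw [alternant, Matrix.det_apply']
  rfl

theorem alternant_eq_sum' (y : Fin N → R) (e : Fin N → ℕ) :
    alternant y e = ∑ w : Perm (Fin N), ((Perm.sign w : ℤ) : R) * ∏ i, y (w i) ^ e i := by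
  rw [alternant, ← Matrix.det_transpose, Matrix.det_apply']
  rfl

theorem map_alternant {S : Type*} [CommRing S] (φ : R →+* S) (y : Fin N → R) (e : Fin N → ℕ) :
    alternant (fun i => φ (y i)) e = φ (alternant y e) := by
  simp [alternant_eq_sum]

theorem alternant_mul (a : R) (y : Fin N → R) (e : Fin N → ℕ) :
    alternant (fun i => y i * a) e = a ^ (∑ i, e i) * alternant y e := by
  simp_rw [alternant_eq_sum, Finset.mul_sum, mul_pow, Finset.prod_mul_distrib]
  refine Finset.sum_congr rfl fun w _ => ?_
  rw [Finset.prod_pow_eq_pow_sum, Equiv.sum_comp w e]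
  ring

theorem alternant_staircase (y : Fin N → R) :
    alternant y (staircase N) = ∏ i, ∏ j ∈ Finset.Ioi i, (y i - y j) := by
  have h := Matrix.det_projVandermonde (fun _ => 1) y
  simp only [one_mul] at h
  rw [alternant, ← Matrix.det_transpose, ← h]
  congr 1
  ext i j
  simp [Matrix.projVandermonde_apply, staircase]

theorem prod_add_mul_eq_sum_range {ι : Type*} [DecidableEq ι] (s : Finset ι) (a b : R) (c : ι → R) :
    ∏ j ∈ s, (a + b * c j) = ∑ k ∈ Finset.range (s.card + 1),
      a ^ k * b ^ (s.card - k) * ∑ t ∈ s.powersetCard k, ∏ j ∈ s \ t, c j := by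
  rw [Finset.prod_add, Finset.sum_powerset]
  refine Finset.sum_congr rfl fun k _ => ?_
  rw [Finset.mul_sum]
  refine Finset.sum_congr rfl fun t ht => ?_
  obtain ⟨hts, rfl⟩ := Finset.mem_powersetCard.1 ht
  rw [Finset.prod_const, Finset.prod_mul_distrib, Finset.prod_const, Finset.card_sdiff_of_subset hts,
    mul_assoc]

theorem prod_prod_erase_sub (y : Fin N → R) :
    ∏ i, ∏ j ∈ Finset.univ.erase i, (y i - y j) =
      (∏ i, ∏ j ∈ Finset.Ioi i, (y j - y i)) * ∏ i, ∏ j ∈ Finset.Ioi i, (y i - y j) := by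
  have hsplit : ∀ i : Fin N, ∏ j ∈ Finset.univ.erase i, (y i - y j) =
      (∏ j ∈ Finset.Iio i, (y i - y j)) * ∏ j ∈ Finset.Ioi i, (y i - y j) := fun i => by
    rw [← Finset.prod_union]
    · refine Finset.prod_congr ?_ fun _ _ => rfl
      ext j
      simp
    · rw [Finset.disjoint_left]
      intro j hj hj'
      exact lt_asymm (Finset.mem_Iio.1 hj) (Finset.mem_Ioi.1 hj')
  simp_rw [hsplit]
  rw [Finset.prod_mul_distrib]
  congr 1
  exact Finset.prod_comm' (by simp)

/-- Cauchy's determinant, with denominators cleared. -/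
theorem det_prod_erase_one_sub_mul [IsDomain R] (x y : Fin N → R) (hy : Function.Injective y) :
    Matrix.det (Matrix.of fun i j => ∏ k ∈ Finset.univ.erase j, (1 - x i * y k)) =
      alternant x (staircase N) * alternant y (staircase N) := by
  -- Column `j` of `E` holds the coefficients of the binary form ∏_{k ≠ j} (a - b y_k). Keeping it
  -- homogeneous in (a, b) allows evaluation at both (1, x_i) and (y_i, 1).
  let E : Matrix (Fin N) (Fin N) R := Matrix.of fun k j =>
    ∑ t ∈ (Finset.univ.erase j).powersetCard k, ∏ m ∈ (Finset.univ.erase j) \ t, -y m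
  have hE : ∀ (a b : R) (j : Fin N), ∏ k ∈ Finset.univ.erase j, (a + b * -y k) =
      ∑ k : Fin N, a ^ (k : ℕ) * b ^ staircase N k * E k j := by
    intro a b j
    have hN : (Finset.univ.erase j : Finset (Fin N)).card + 1 = N := by
      rw [Finset.card_erase_add_one (Finset.mem_univ j)]
      simp
    rw [prod_add_mul_eq_sum_range, hN, ← Fin.sum_univ_eq_sum_range (fun k : ℕ =>
      a ^ k * b ^ ((Finset.univ.erase j : Finset (Fin N)).card - k) *
        ∑ t ∈ (Finset.univ.erase j : Finset (Fin N)).powersetCard k,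
          ∏ m ∈ (Finset.univ.erase j) \ t, -y m)]
    refine Finset.sum_congr rfl fun k _ => ?_
    have hk : (Finset.univ.erase j : Finset (Fin N)).card - k = staircase N k := by
      simp only [staircase, Fin.val_rev]
      omega
    rw [hk]
    rfl
  have h1 : (Matrix.of fun i j => ∏ k ∈ Finset.univ.erase j, (1 - x i * y k)) =
      (Matrix.of fun i j => x j ^ staircase N i : Matrix (Fin N) (Fin N) R).transpose * E := by
    ext i j
    have h := hE 1 (x i) j
    simp only [mul_neg, ← sub_eq_add_neg, one_pow, one_mul] at h
    rw [Matrix.of_apply, h, Matrix.mul_apply]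
    rfl
  -- At (y_i, 1) the form with index `j ≠ i` has a zero factor, so this product is diagonal and
  -- determines `E.det`.
  have h2 : Matrix.vandermonde y * E =
      Matrix.diagonal fun i => ∏ k ∈ Finset.univ.erase i, (y i - y k) := by
    ext i j
    have h := hE (y i) 1 j
    simp only [one_mul, one_pow, mul_one, ← sub_eq_add_neg] at h
    rw [Matrix.mul_apply, Matrix.diagonal_apply]
    simp only [Matrix.vandermonde_apply]
    rw [← h]
    split_ifs with hij
    · rw [hij]
    · exact Finset.prod_eq_zero (Finset.mem_erase.2 ⟨hij, Finset.mem_univ _⟩) (sub_self _)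
  have h3 : E.det = alternant y (staircase N) := by
    have h := congrArg Matrix.det h2
    rw [Matrix.det_mul, Matrix.det_diagonal, prod_prod_erase_sub, Matrix.det_vandermonde,
      ← Matrix.det_vandermonde] at h
    rw [alternant_staircase]
    exact mul_left_cancel₀ (Matrix.det_vandermonde_ne_zero_iff.2 hy) h
  rw [h1, Matrix.det_mul, Matrix.det_transpose, h3]
  rfl

theorem geom_mul_one_sub (a : R) :
    (PowerSeries.mk fun s => a ^ s) * (1 - PowerSeries.C a * PowerSeries.X) = 1 := by
  ext m
  rw [mul_sub, mul_one, map_sub, mul_left_comm, PowerSeries.coeff_C_mul, PowerSeries.coeff_mk]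
  cases m with
  | zero => simp
  | succ m => simp [PowerSeries.coeff_succ_mul_X, PowerSeries.coeff_one, pow_succ']

theorem coeff_prod_geom {ι : Type*} [Fintype ι] [DecidableEq ι] (z : ι → R) (m : ℕ) :
    PowerSeries.coeff m (∏ a, PowerSeries.mk fun s => z a ^ s) = completeSum m z := by
  rw [PowerSeries.coeff_prod, completeSum]
  simp only [PowerSeries.coeff_mk]

/-- This is the coefficient of t^{n + |δ|} in det (1 / (1 - x_i y_j t)), computed once by Cauchy's
determinant and once by the Leibniz expansion. -/
theorem alternant_mul_completeSum [IsDomain R] (x y : Fin N → R) (hy : Function.Injective y)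
    (n : ℕ) :
    alternant x (staircase N) * alternant y (staircase N) *
        completeSum n (fun p : Fin N × Fin N => x p.1 * y p.2) =
      ∑ w : Perm (Fin N), ((Perm.sign w : ℤ) : R) *
        completeSum (n + ∑ i, staircase N i) fun i => x i * y (w i) := by
  let G : Matrix (Fin N) (Fin N) (PowerSeries R) :=
    Matrix.of fun i j => PowerSeries.mk fun s => (x i * y j) ^ s
  -- The variable t is absorbed into the x_i, so their alternant acquires the factor t^{|δ|}; this
  -- accounts for the shift of degree.
  let x' : Fin N → PowerSeries R := fun i => PowerSeries.C (x i) * PowerSeries.X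
  let y' : Fin N → PowerSeries R := fun i => PowerSeries.C (y i)
  have hG : ∀ i j, G i j * (1 - x' i * y' j) = 1 := fun i j => by
    have h := geom_mul_one_sub (x i * y j)
    rwa [map_mul, mul_right_comm] at h
  -- Row `i` of the denominator-free matrix is multiplied by ∏_k 1 / (1 - x_i y_k t).
  have h1 : G.det = (∏ i, ∏ j, G i j) *
      Matrix.det (Matrix.of fun i j => ∏ k ∈ Finset.univ.erase j, (1 - x' i * y' k)) := by
    rw [← Matrix.det_mul_column]
    congr 1
    ext1 i j
    rw [Matrix.of_apply, Matrix.of_apply, ← Finset.mul_prod_erase _ _ (Finset.mem_univ j), mul_assoc,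
      ← Finset.prod_mul_distrib, Finset.prod_congr rfl fun k _ => hG i k, Finset.prod_const_one,
      mul_one]
  have hx' : alternant x' (staircase N) =
      PowerSeries.X ^ (∑ i, staircase N i) * PowerSeries.C (alternant x (staircase N)) := by
    rw [← map_alternant, ← alternant_mul]
  rw [det_prod_erase_one_sub_mul x' y' (PowerSeries.C_injective.comp hy), hx',
    show alternant y' (staircase N) = PowerSeries.C (alternant y (staircase N)) from
      map_alternant _ _ _] at h1
  have h2 : (∏ i, ∏ j, G i j) = ∏ p : Fin N × Fin N, PowerSeries.mk fun s => (x p.1 * y p.2) ^ s :=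
    (Fintype.prod_prod_type fun p : Fin N × Fin N =>
      PowerSeries.mk fun s => (x p.1 * y p.2) ^ s).symm
  have h3 := congrArg (PowerSeries.coeff (n + ∑ i, staircase N i)) h1
  rw [h2, show ∀ A B C D : PowerSeries R, A * (B * C * D) = C * (D * (A * B)) by intros; ring,
    PowerSeries.coeff_C_mul, PowerSeries.coeff_C_mul, PowerSeries.coeff_mul_X_pow, coeff_prod_geom,
    ← mul_assoc] at h3
  rw [← h3, ← Matrix.det_transpose, Matrix.det_apply', map_sum]
  refine Finset.sum_congr rfl fun w _ => ?_
  rw [← coeff_prod_geom, ← PowerSeries.coeff_C_mul, map_intCast]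
  rfl

end Cauchy

/-! ### Frobenius' class function and its norm. -/

section Frobenius

variable {N n : ℕ}

/-- The value at `g` of the alternating sum of permutation characters whose generating function is
`alternant X (staircase N) * fixedWordSum g X`. -/
noncomputable def frobeniusChar (l : Fin N →₀ ℕ) (g : Perm (Fin n)) : ℤ :=
  ∑ w : Perm (Fin N), (Perm.sign w : ℤ) * (Finset.univ.filter fun f : Fin n → Fin N =>
    f ∘ g = f ∧ ∀ r, content f r + staircase N (w r) = l r).card

variable {R : Type*} [CommRing R]

theorem coeff_alternant_mul_fixedWordSum (l : Fin N →₀ ℕ) (g : Perm (Fin n)) :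
    MvPolynomial.coeff l (alternant MvPolynomial.X (staircase N) *
      fixedWordSum g MvPolynomial.X : MvPolynomial (Fin N) R) = frobeniusChar l g := by
  have hw : ∀ w : Perm (Fin N), ∏ i, (MvPolynomial.X i : MvPolynomial (Fin N) R) ^ staircase N (w i) =
      MvPolynomial.monomial (Finsupp.equivFunOnFinite.symm fun i => staircase N (w i)) 1 :=
    fun w => prod_X_pow (Finsupp.equivFunOnFinite.symm fun i => staircase N (w i))
  rw [alternant_eq_sum, Finset.sum_mul, MvPolynomial.coeff_sum, frobeniusChar, Int.cast_sum]
  refine Finset.sum_congr rfl fun w _ => ?_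
  rw [hw, mul_assoc, coeff_intCast_mul,
    Int.cast_mul, fixedWordSum, Finset.mul_sum, MvPolynomial.coeff_sum]
  congr 1
  simp_rw [← monomial_content, MvPolynomial.monomial_mul, mul_one, MvPolynomial.coeff_monomial]
  rw [Finset.sum_boole, Finset.filter_filter, Int.cast_natCast]
  congr 3
  ext f
  refine and_congr_right fun _ => ?_
  rw [DFunLike.ext_iff]
  exact forall_congr' fun r => by rw [Finsupp.add_apply, add_comm]; rfl

theorem map_fixedWordSum {S σ : Type*} [CommRing S] [Fintype σ] [DecidableEq σ] (φ : R →+* S)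
    (g : Perm (Fin n)) (y : σ → R) :
    fixedWordSum g (fun i => φ (y i)) = φ (fixedWordSum g y) := by
  simp [fixedWordSum]

/-- The Frobenius characteristic of `frobeniusChar l` is a_l / a_δ. This follows by taking the
coefficient of x^l in the Cauchy identity, with the y's as constants. -/
theorem alternant_mul_sum_frobeniusChar [IsDomain R] (l : Fin N →₀ ℕ)
    (hl : ∑ i, l i = n + ∑ i, staircase N i) (y : Fin N → R) (hy : Function.Injective y) :
    alternant y (staircase N) * ∑ g : Perm (Fin n), (frobeniusChar l g : R) * fixedWordSum g y =
      n.factorial * alternant y l := by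
  let y' : Fin N → MvPolynomial (Fin N) R := fun i => MvPolynomial.C (y i)
  have h := alternant_mul_completeSum MvPolynomial.X y'
    ((MvPolynomial.C_injective _ _).comp hy) n
  have h2 : ∑ g : Perm (Fin n), MvPolynomial.C (alternant y (staircase N) * fixedWordSum g y) *
      (alternant MvPolynomial.X (staircase N) * fixedWordSum g MvPolynomial.X) =
      MvPolynomial.C (n.factorial : R) * ∑ w : Perm (Fin N),
        MvPolynomial.C ((Perm.sign w : ℤ) : R) *
        completeSum (n + ∑ i, staircase N i) fun i => MvPolynomial.X i * y' (w i) := by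
    simp_rw [map_intCast]
    rw [← h, map_natCast, mul_left_comm, ← sum_fixedWordSum, Finset.mul_sum]
    refine Finset.sum_congr rfl fun g _ => ?_
    rw [← fixedWordSum_mul, map_mul, ← map_alternant, ← map_fixedWordSum]
    ring
  have hc : ∀ w : Perm (Fin N), MvPolynomial.coeff l (completeSum (n + ∑ i, staircase N i)
      fun i => MvPolynomial.X i * y' (w i)) = ∏ i, y (w i) ^ l i := by
    intro w
    have hterm : ∀ c : Fin N →₀ ℕ, ∏ i, (MvPolynomial.X i * y' (w i)) ^ c i =
        MvPolynomial.monomial c (∏ i, y (w i) ^ c i) := fun c => by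
      simp_rw [mul_pow]
      rw [Finset.prod_mul_distrib, prod_X_pow, mul_comm, ← mul_one (∏ i, y (w i) ^ c i),
        ← MvPolynomial.C_mul_monomial, map_prod]
      simp [y']
    rw [completeSum, MvPolynomial.coeff_sum, Finset.sum_eq_single l]
    · rw [hterm, MvPolynomial.coeff_monomial, if_pos rfl]
    · intro c _ hc
      rw [hterm, MvPolynomial.coeff_monomial, if_neg hc]
    · intro hl'
      exact absurd (Finset.mem_finsuppAntidiag.2 ⟨hl, Finset.subset_univ _⟩) hl'
  have h3 := congrArg (MvPolynomial.coeff l) h2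
  simp_rw [MvPolynomial.coeff_sum, MvPolynomial.coeff_C_mul, MvPolynomial.coeff_sum,
    MvPolynomial.coeff_C_mul, coeff_alternant_mul_fixedWordSum, hc] at h3
  rw [Finset.mul_sum, alternant_eq_sum' y l]
  exact (Finset.sum_congr rfl fun g _ => by ring).trans h3

/-- The coefficient of y^l is taken once more. Since the l_i are distinct, only the identity
permutation contributes y^l to a_l. -/
theorem sum_frobeniusChar_sq (l : Fin N →₀ ℕ) (hl : ∑ i, l i = n + ∑ i, staircase N i)
    (hinj : Function.Injective l) :
    ∑ g : Perm (Fin n), frobeniusChar l g ^ 2 = n.factorial := by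
  have h := alternant_mul_sum_frobeniusChar (n := n) l hl
    (MvPolynomial.X : Fin N → MvPolynomial (Fin N) ℤ) MvPolynomial.X_injective
  have h1 : MvPolynomial.coeff l (alternant MvPolynomial.X l : MvPolynomial (Fin N) ℤ) = 1 := by
    have hw : ∀ w : Perm (Fin N), ∏ i, (MvPolynomial.X i : MvPolynomial (Fin N) ℤ) ^ l (w i) =
        MvPolynomial.monomial (Finsupp.equivFunOnFinite.symm fun i => l (w i)) 1 :=
      fun w => prod_X_pow (Finsupp.equivFunOnFinite.symm fun i => l (w i))
    rw [alternant_eq_sum, MvPolynomial.coeff_sum, Finset.sum_eq_single 1]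
    · rw [hw, coeff_intCast_mul,
        MvPolynomial.coeff_monomial,
        if_pos (show (Finsupp.equivFunOnFinite.symm fun i => l ((1 : Perm (Fin N)) i)) = l from
          Finsupp.ext fun _ => rfl)]
      simp
    · intro w _ hw1
      rw [hw, coeff_intCast_mul, MvPolynomial.coeff_monomial, if_neg, mul_zero]
      intro heq
      exact hw1 (Equiv.ext fun i => hinj (DFunLike.congr_fun heq i))
    · exact fun h => absurd (Finset.mem_univ _) h
  have h2 := congrArg (MvPolynomial.coeff l) h
  rw [← map_natCast (MvPolynomial.C (σ := Fin N)), MvPolynomial.coeff_C_mul, h1, mul_one,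
    Finset.mul_sum, MvPolynomial.coeff_sum] at h2
  refine Eq.trans (Finset.sum_congr rfl fun g _ => ?_) h2
  rw [mul_left_comm, coeff_intCast_mul,
    coeff_alternant_mul_fixedWordSum, sq]
  simp

end Frobenius

/-! ### Hook lengths and the shifted parts λ + δ. -/

section Hooks

variable (μ : YoungDiagram) {N : ℕ}

/-- The strictly decreasing sequence `λ_i + (N - 1 - i)`. -/
noncomputable def shiftedParts (N : ℕ) : Fin N →₀ ℕ :=
  Finsupp.equivFunOnFinite.symm fun i => μ.rowLen i + staircase N i

theorem shiftedParts_apply (i : Fin N) : shiftedParts μ N i = μ.rowLen i + staircase N i := rfl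

theorem staircase_add (i : Fin N) : staircase N i + i + 1 = N := by
  rw [staircase, Fin.val_rev]
  omega

theorem strictAnti_staircase : StrictAnti (staircase N) := fun i j h => by
  have := staircase_add i
  have := staircase_add j
  have : (i : ℕ) < j := h
  omega

theorem strictAnti_shiftedParts : StrictAnti (shiftedParts μ N) := fun _ _ h =>
  add_lt_add_of_le_of_lt (μ.rowLen_anti _ _ (Fin.le_def.1 h.le)) (strictAnti_staircase h)

theorem rowLen_eq_zero {r : ℕ} (hr : μ.colLen 0 ≤ r) : μ.rowLen r = 0 := by
  by_contra h
  have h1 : (r, 0) ∈ μ := YoungDiagram.mem_iff_lt_rowLen.2 (Nat.pos_of_ne_zero h)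
  exact absurd (YoungDiagram.mem_iff_lt_colLen.1 h1) (not_lt.2 hr)

theorem prod_cells_eq {M : Type*} [CommMonoid M] (hN : μ.colLen 0 ≤ N) (φ : ℕ × ℕ → M) :
    ∏ c ∈ μ.cells, φ c = ∏ i : Fin N, ∏ c ∈ Finset.range (μ.rowLen i), φ (i, c) := by
  rw [Fin.prod_univ_eq_prod_range (fun i => ∏ c ∈ Finset.range (μ.rowLen i), φ (i, c)),
    Finset.prod_sigma']
  refine Finset.prod_bij' (fun c _ => ⟨c.1, c.2⟩) (fun c _ => (c.1, c.2)) ?_ ?_ ?_ ?_ ?_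
  · intro c hc
    have hc' : (c.1, c.2) ∈ μ := hc
    have h1 := YoungDiagram.mem_iff_lt_rowLen.1 hc'
    have h2 := YoungDiagram.mem_iff_lt_colLen.1 hc'
    have h3 := μ.colLen_anti 0 c.2 (Nat.zero_le _)
    simp only [Finset.mem_sigma, Finset.mem_range]
    exact ⟨by omega, h1⟩
  · intro c hc
    simp only [Finset.mem_sigma, Finset.mem_range] at hc
    exact (YoungDiagram.mem_cells _).2 (YoungDiagram.mem_iff_lt_rowLen.2 hc.2)
  · exact fun _ _ => rfl
  · exact fun _ _ => rfl
  · exact fun _ _ => rfl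

/-- The hook lengths in row `i` and the differences `l_i - l_j`, `j > i`, exhaust `1, …, l_i`. -/
theorem prod_hookLength_mul_prod_sub {M : Type*} [CommMonoid M] (hN : μ.colLen 0 ≤ N)
    (φ : ℕ → M) (i : Fin N) :
    (∏ c ∈ Finset.range (μ.rowLen i), φ (hookLength μ (i, c))) *
        ∏ j ∈ Finset.Ioi i, φ (shiftedParts μ N i - shiftedParts μ N j) =
      ∏ s ∈ Finset.Icc 1 (shiftedParts μ N i), φ s := by
  have hlr : ∀ r c, c < μ.rowLen r ↔ r < μ.colLen c := fun r c => by
    rw [← YoungDiagram.mem_iff_lt_rowLen, YoungDiagram.mem_iff_lt_colLen]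
  have hhook : ∀ c < μ.rowLen i, hookLength μ (i, c) + c + i + 1 = μ.rowLen i + μ.colLen c := by
    intro c hc
    have := (hlr i c).1 hc
    simp only [hookLength]
    omega
  have hinj1 : Set.InjOn (fun c => hookLength μ (i, c)) (Finset.range (μ.rowLen i)) := by
    intro c hc c' hc' h
    have h1 := hhook c (Finset.mem_range.1 hc)
    have h2 := hhook c' (Finset.mem_range.1 hc')
    simp only at h
    rcases lt_trichotomy c c' with hlt | heq | hlt
    · have := μ.colLen_anti c c' hlt.le
      omega
    · exact heq
    · have := μ.colLen_anti c' c hlt.le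
      omega
  have hlt : ∀ j ∈ Finset.Ioi i, shiftedParts μ N j < shiftedParts μ N i := fun j hj =>
    strictAnti_shiftedParts μ (Finset.mem_Ioi.1 hj)
  have hinj2 : Set.InjOn (fun j => shiftedParts μ N i - shiftedParts μ N j)
      (Finset.Ioi i : Finset (Fin N)) := by
    intro j hj j' hj' h
    have h1 := hlt j hj
    have h2 := hlt j' hj'
    simp only at h
    exact (strictAnti_shiftedParts μ).injective (by omega)
  -- A coincidence would mean λ'_c + λ_j = j + c + 1, with λ'_c the length of column c. The left
  -- side is at least j + c + 2 if (j, c) is a box, and at most j + c if not.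
  have hdisj : Disjoint ((Finset.range (μ.rowLen i)).image fun c => hookLength μ (i, c))
      ((Finset.Ioi i).image fun j => shiftedParts μ N i - shiftedParts μ N j) := by
    rw [Finset.disjoint_left]
    intro s hs hs'
    obtain ⟨c, hc, rfl⟩ := Finset.mem_image.1 hs
    obtain ⟨j, hj, h⟩ := Finset.mem_image.1 hs'
    have h1 := hhook c (Finset.mem_range.1 hc)
    have h2 := hlt j hj
    have h3 : (i : ℕ) < j := Fin.lt_def.1 (Finset.mem_Ioi.1 hj)
    have h4 := hlr j c
    have h5 := staircase_add i
    have h6 := staircase_add j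
    simp only [shiftedParts_apply] at h h2
    by_cases hjc : (j : ℕ) < μ.colLen c
    · have := h4.2 hjc
      omega
    · have := mt h4.1 hjc
      omega
  rw [← Finset.prod_image (f := φ) hinj1, ← Finset.prod_image (f := φ) hinj2,
    ← Finset.prod_union hdisj]
  congr 1
  -- Both sets lie in 1, …, l_i, and together they have λ_i + (N - 1 - i) = l_i elements.
  refine Finset.eq_of_subset_of_card_le (Finset.union_subset ?_ ?_) ?_
  · intro s hs
    obtain ⟨c, hc, rfl⟩ := Finset.mem_image.1 hs
    have h1 := hhook c (Finset.mem_range.1 hc)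
    have h2 := μ.colLen_anti 0 c (Nat.zero_le _)
    have h3 := (hlr i c).1 (Finset.mem_range.1 hc)
    have h4 := staircase_add i
    have h5 : c < μ.rowLen i := Finset.mem_range.1 hc
    simp only [Finset.mem_Icc, shiftedParts_apply]
    omega
  · intro s hs
    obtain ⟨j, hj, rfl⟩ := Finset.mem_image.1 hs
    have h2 := hlt j hj
    simp only [Finset.mem_Icc]
    omega
  · rw [Finset.card_union_of_disjoint hdisj, Finset.card_image_of_injOn hinj1,
      Finset.card_image_of_injOn hinj2, Finset.card_range, Nat.card_Icc, Fin.card_Ioi]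
    have h4 := staircase_add i
    simp only [shiftedParts_apply]
    omega

theorem sum_shiftedParts (hN : μ.colLen 0 ≤ N) :
    ∑ i, shiftedParts μ N i = μ.card + ∑ i, staircase N i := by
  simp_rw [shiftedParts_apply, Finset.sum_add_distrib]
  congr 1
  have h := prod_cells_eq μ hN fun _ => Multiplicative.ofAdd 1
  simp only [Finset.prod_const, Finset.card_range, ← ofAdd_nsmul, ← ofAdd_sum] at h
  simpa using (Multiplicative.ofAdd.injective h).symm

theorem sum_mul_shiftedParts (hN : μ.colLen 0 ≤ N) :
    ∑ i : Fin N, i * shiftedParts μ N i = nStat μ + ∑ i : Fin N, i * staircase N i := by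
  simp_rw [shiftedParts_apply, mul_add, Finset.sum_add_distrib]
  congr 1
  rw [Fin.sum_univ_eq_sum_range (fun i => i * μ.rowLen i), nStat]
  refine (Finset.sum_subset (Finset.range_mono hN) fun r _ hr => ?_).symm
  rw [rowLen_eq_zero μ (by simpa using hr), mul_zero]

end Hooks

/-! ### The specialization y_j = q^j. -/

section PrincipalSpecialization

open PowerSeries

variable {R : Type*} [CommRing R] {N : ℕ}

/-- At y_j = q^j the alternant is the Vandermonde determinant of the q^{e_i}. Taking the smaller
power out of each difference removes q^{e_j} exactly j times. -/
theorem alternant_X_pow (e : Fin N → ℕ) (he : StrictAnti e) :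
    alternant (fun j : Fin N => (X : R⟦X⟧) ^ (j : ℕ)) e =
      X ^ (∑ j : Fin N, j * e j) * ∏ i, ∏ j ∈ Finset.Ioi i, (1 - X ^ (e i - e j)) := by
  have h1 : alternant (fun j : Fin N => (X : R⟦X⟧) ^ (j : ℕ)) e =
      (Matrix.vandermonde fun i => (X : R⟦X⟧) ^ e i).det := by
    rw [alternant]
    congr 1
    ext1 i j
    rw [Matrix.of_apply, Matrix.vandermonde_apply, ← pow_mul, ← pow_mul, mul_comm]
  have h2 : ∀ i, ∀ j ∈ Finset.Ioi i, (X : R⟦X⟧) ^ e j - X ^ e i = X ^ e j * (1 - X ^ (e i - e j)) := by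
    intro i j hj
    rw [mul_sub, mul_one, ← pow_add, Nat.add_sub_cancel' (he (Finset.mem_Ioi.1 hj)).le]
  rw [h1, Matrix.det_vandermonde, Finset.prod_congr rfl fun i _ => Finset.prod_congr rfl (h2 i)]
  simp_rw [Finset.prod_mul_distrib]
  congr 1
  rw [Finset.prod_comm' (t' := Finset.univ) (s' := fun j => Finset.Iio j) (by simp),
    ← Finset.prod_pow_eq_pow_sum]
  refine Finset.prod_congr rfl fun j _ => ?_
  rw [Finset.prod_const, Fin.card_Iio, ← pow_mul, mul_comm]

theorem one_sub_X_pow_ne_zero [Nontrivial R] {k : ℕ} (hk : k ≠ 0) : (1 - X ^ k : R⟦X⟧) ≠ 0 := by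
  intro h
  have := congrArg (coeff 0) h
  simp [hk] at this

/-- The hook formula for `F` = `K` a_l / a_δ. The product on the right runs over the factors 1 -
q^{N + c}, one for each box of content c. -/
theorem mul_prod_hookLength [IsDomain R] (μ : YoungDiagram) (hN : μ.colLen 0 ≤ N) (F : R⟦X⟧) (K : R⟦X⟧)
    (hF : alternant (fun j : Fin N => (X : R⟦X⟧) ^ (j : ℕ)) (staircase N) * F =
      K * alternant (fun j : Fin N => (X : R⟦X⟧) ^ (j : ℕ)) (shiftedParts μ N)) :
    F * ∏ c ∈ μ.cells, (1 - X ^ hookLength μ c) = K * X ^ nStat μ *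
      ∏ i : Fin N, ∏ s ∈ Finset.Ioc (staircase N i) (shiftedParts μ N i), (1 - X ^ s) := by
  -- For the empty diagram the shifted parts are δ, so the same row lemma evaluates the product `A`
  -- coming from a_δ.
  have hcol : (⊥ : YoungDiagram).colLen 0 ≤ 0 := by
    by_contra h
    exact YoungDiagram.notMem_bot _ (YoungDiagram.mem_iff_lt_colLen.2 (not_le.1 h))
  have hrow : ∀ r, (⊥ : YoungDiagram).rowLen r = 0 := fun r =>
    rowLen_eq_zero _ (hcol.trans (Nat.zero_le r))
  have hbot : ∀ i : Fin N, shiftedParts ⊥ N i = staircase N i := fun i => by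
    rw [shiftedParts_apply, hrow, zero_add]
  set A : R⟦X⟧ := ∏ i, ∏ j ∈ Finset.Ioi i, (1 - X ^ (staircase N i - staircase N j)) with hA
  set B : R⟦X⟧ := ∏ i, ∏ j ∈ Finset.Ioi i, (1 - X ^ (shiftedParts μ N i - shiftedParts μ N j)) with hB
  set T : R⟦X⟧ :=
    ∏ i : Fin N, ∏ s ∈ Finset.Ioc (staircase N i) (shiftedParts μ N i), (1 - X ^ s) with hT
  have hA' : A = ∏ i : Fin N, ∏ s ∈ Finset.Icc 1 (staircase N i), (1 - X ^ s) := by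
    refine Finset.prod_congr rfl fun i _ => ?_
    have h := prod_hookLength_mul_prod_sub ⊥ (hcol.trans (Nat.zero_le N))
      (fun s => (1 - X ^ s : R⟦X⟧)) i
    simpa [hrow, hbot] using h
  have hHB : (∏ c ∈ μ.cells, (1 - X ^ hookLength μ c)) * B = A * T := by
    rw [prod_cells_eq μ hN, hB, ← Finset.prod_mul_distrib, hA', hT, ← Finset.prod_mul_distrib]
    refine Finset.prod_congr rfl fun i _ => ?_
    rw [prod_hookLength_mul_prod_sub μ hN (fun s => (1 - X ^ s : R⟦X⟧)) i]
    exact (Finset.prod_Ioc_consecutive (fun s => (1 - X ^ s : R⟦X⟧)) (Nat.zero_le _)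
      (Nat.le_add_left _ _)).symm
  rw [alternant_X_pow _ strictAnti_staircase, alternant_X_pow _ (strictAnti_shiftedParts μ),
    sum_mul_shiftedParts μ hN, pow_add] at hF
  have hA0 : A ≠ 0 := Finset.prod_ne_zero_iff.2 fun i _ => Finset.prod_ne_zero_iff.2 fun j hj =>
    one_sub_X_pow_ne_zero (Nat.sub_ne_zero_of_lt (strictAnti_staircase (Finset.mem_Ioi.1 hj)))
  refine mul_left_cancel₀ (mul_ne_zero (pow_ne_zero (∑ i : Fin N, i * staircase N i) X_ne_zero) hA0) ?_
  rw [← mul_assoc, hF]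
  linear_combination (K * X ^ nStat μ * X ^ (∑ i : Fin N, i * staircase N i)) * hHB

theorem X_pow_dvd_prod_one_sub_X_pow_sub_one {ι : Type*} (t : Finset ι) (e : ι → ℕ) (d : ℕ)
    (he : ∀ a ∈ t, d ≤ e a) : (X : R⟦X⟧) ^ d ∣ ∏ a ∈ t, (1 - X ^ e a) - 1 := by
  refine Finset.prod_induction _ (fun p => (X : R⟦X⟧) ^ d ∣ p - 1) (fun p q hp hq => ?_) (by simp)
    fun a ha => ?_
  · rw [show p * q - 1 = p * (q - 1) + (p - 1) by ring]
    exact dvd_add (hq.mul_left _) hp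
  · rw [show (1 - X ^ e a - 1 : R⟦X⟧) = -X ^ e a by ring]
    exact (pow_dvd_pow _ (he a ha)).neg_right

theorem mk_dvd_mul_one_sub_X_pow {h : ℕ} (hh : 0 < h) :
    (mk fun s => if h ∣ s then (1 : R) else 0) * (1 - X ^ h) = 1 := by
  ext m
  rw [mul_sub, mul_one, map_sub, coeff_mul_X_pow', coeff_mk, coeff_one]
  by_cases hm : h ≤ m
  · rw [if_pos hm, coeff_mk, if_neg (by omega : ¬ m = 0)]
    have hiff : h ∣ m - h ↔ h ∣ m := by
      rw [Nat.dvd_sub_iff_left hm dvd_rfl]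
    simp only [hiff, sub_self]
  · rw [if_neg hm, sub_zero]
    congr 1
    exact propext ⟨fun hd => Nat.eq_zero_of_dvd_of_lt hd (not_le.1 hm), fun h0 => h0 ▸ dvd_zero h⟩

theorem coeff_prod_mk_dvd {n : ℕ} (h : Fin n → ℕ) (hh : ∀ i, 0 < h i) (m : ℕ) :
    coeff m (∏ i, mk fun s => if h i ∣ s then (1 : R) else 0) =
      Set.ncard {y : Fin n → ℕ | ∑ i, h i * y i = m} := by
  rw [coeff_prod]
  simp only [coeff_mk]
  simp_rw [Finset.prod_ite_zero, Finset.prod_const_one]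
  rw [Finset.sum_boole, ← Set.ncard_coe_finset]
  congr 1
  refine (Set.ncard_congr (fun y _ => Finsupp.equivFunOnFinite.symm fun i => h i * y i) ?_ ?_ ?_).symm
  · intro y hy
    simpa using hy
  · intro y y' _ _ heq
    funext i
    exact Nat.eq_of_mul_eq_mul_left (hh i) (DFunLike.congr_fun heq i)
  · intro c hc
    simp only [Finset.coe_filter, Finset.mem_finsuppAntidiag, Set.mem_ofPred_eq, Finset.mem_univ,
      true_imp_iff] at hc
    choose y hy using hc.2
    refine ⟨y, ?_, Finsupp.ext fun i => (hy i).symm⟩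
    rw [Set.mem_ofPred_eq, ← hc.1.1]
    exact Finset.sum_congr rfl fun i _ => (hy i).symm

/-- With `N` this large the numerator factors do not affect the coefficient of q^d, and the hook
factors invert to geometric series. -/
theorem coeff_eq_ncard [IsDomain R] {n d : ℕ} (μ : YoungDiagram) (hN : μ.colLen 0 + d ≤ N)
    (box : Fin n ≃ μ.cells) (F : R⟦X⟧) (K : R)
    (hF : alternant (fun j : Fin N => (X : R⟦X⟧) ^ (j : ℕ)) (staircase N) * F =
      C K * alternant (fun j : Fin N => (X : R⟦X⟧) ^ (j : ℕ)) (shiftedParts μ N)) :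
    coeff d F = K * Set.ncard {y : Fin n → ℕ |
      ∑ i, (hookLength μ (box i) : ℤ) * (y i : ℤ) = (d : ℤ) - (nStat μ : ℤ)} := by
  have h := mul_prod_hookLength μ ((Nat.le_add_right _ d).trans hN) F (C K) hF
  have hbox : ∏ c ∈ μ.cells, (1 - X ^ hookLength μ c : R⟦X⟧) =
      ∏ i, (1 - X ^ hookLength μ (box i)) := by
    rw [← Finset.prod_coe_sort]
    exact (Equiv.prod_comp box fun c : μ.cells => (1 - X ^ hookLength μ c : R⟦X⟧)).symm
  have hpos : ∀ i, 0 < hookLength μ (box i) := fun i => Nat.succ_pos _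
  have hinv : (∏ i, (1 - X ^ hookLength μ (box i) : R⟦X⟧)) *
      ∏ i, (mk fun s => if hookLength μ (box i) ∣ s then (1 : R) else 0) = 1 := by
    rw [← Finset.prod_mul_distrib]
    refine Finset.prod_eq_one fun i _ => ?_
    rw [mul_comm, mk_dvd_mul_one_sub_X_pow (hpos i)]
  obtain ⟨Q, hQ⟩ : (X : R⟦X⟧) ^ (d + 1) ∣
      ∏ i : Fin N, ∏ s ∈ Finset.Ioc (staircase N i) (shiftedParts μ N i), (1 - X ^ s) - 1 := by
    rw [Finset.prod_sigma']
    refine X_pow_dvd_prod_one_sub_X_pow_sub_one _ _ _ fun a ha => ?_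
    obtain ⟨h1, h2⟩ := Finset.mem_Ioc.1 (Finset.mem_sigma.1 ha).2
    have h3 := staircase_add a.1
    -- Rows past the last one give an empty range; in the others s > N - 1 - i ≥ d.
    by_cases hc : μ.colLen 0 ≤ a.1
    · rw [shiftedParts_apply, rowLen_eq_zero μ hc] at h2
      omega
    · omega
  set P : R⟦X⟧ := ∏ i, (mk fun s => if hookLength μ (box i) ∣ s then (1 : R) else 0) with hP
  have hFP : F = C K * (X ^ nStat μ * P) + X ^ (d + 1) * (C K * X ^ nStat μ * Q * P) := by
    rw [sub_eq_iff_eq_add] at hQ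
    rw [hbox, hQ] at h
    calc F = F * ((∏ i, (1 - X ^ hookLength μ (box i) : R⟦X⟧)) * P) := by rw [hinv, mul_one]
      _ = _ := by rw [← mul_assoc, h]; ring
  rw [hFP, map_add, coeff_X_pow_mul', if_neg (by omega), add_zero, coeff_C_mul, coeff_X_pow_mul']
  congr 1
  split_ifs with hd
  · rw [hP, coeff_prod_mk_dvd _ hpos]
    congr 2
    ext y
    rw [Set.mem_ofPred_eq, Set.mem_ofPred_eq, ← Nat.cast_sub hd]
    norm_cast
  · rw [show {y : Fin n → ℕ | ∑ i, (hookLength μ (box i) : ℤ) * (y i : ℤ) =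
      (d : ℤ) - (nStat μ : ℤ)} = ∅ from Set.eq_empty_of_forall_notMem fun y hy => ?_,
      Set.ncard_empty, Nat.cast_zero]
    have h1 : (0 : ℤ) ≤ ∑ i, (hookLength μ (box i) : ℤ) * (y i : ℤ) :=
      Finset.sum_nonneg fun i _ => by positivity
    rw [Set.mem_ofPred_eq] at hy
    omega

end PrincipalSpecialization

/-! ### Words injective on the columns of a tableau. -/

section ColumnCombinatorics

variable {μ : YoungDiagram} {n : ℕ} (t : Tableau μ n)

/-- The row of the entry `i` in the tableau `t`. -/
def Tableau.rowOf (i : Fin n) : ℕ := (t i).1.1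

/-- The column of the entry `i` in the tableau `t`. -/
def Tableau.colOf (i : Fin n) : ℕ := (t i).1.2

/-- No letter of the word `f` is repeated within a column of `t`. -/
def Tableau.ColumnInjective (f : Fin n → ℕ) : Prop :=
  ∀ i j, t.colOf i = t.colOf j → f i = f j → i = j

theorem Tableau.mem_colStabilizer {π : Perm (Fin n)} :
    π ∈ t.colStabilizer ↔ ∀ i, t.colOf (π i) = t.colOf i := by
  simp [Tableau.colStabilizer, Tableau.colOf]

theorem Tableau.rowOf_lt (i : Fin n) : t.rowOf i < μ.colLen (t.colOf i) :=
  YoungDiagram.mem_iff_lt_colLen.1 ((YoungDiagram.mem_cells _).1 (t i).2)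

theorem Tableau.ext_box {i j : Fin n} (hr : t.rowOf i = t.rowOf j) (hc : t.colOf i = t.colOf j) :
    i = j :=
  t.injective (Subtype.ext (Prod.ext hr hc))

theorem Tableau.exists_box {r c : ℕ} (h : r < μ.colLen c) : ∃ i, t.rowOf i = r ∧ t.colOf i = c := by
  refine ⟨t.symm ⟨(r, c), (YoungDiagram.mem_cells _).2 (YoungDiagram.mem_iff_lt_colLen.2 h)⟩, ?_, ?_⟩ <;>
  simp [Tableau.rowOf, Tableau.colOf]

/-- A word that is injective on columns and dominates the row word of `t` is obtained from the
latter by a column permutation. -/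
theorem Tableau.ColumnInjective.exists_eq_rowOf {f : Fin n → ℕ} (hf : t.ColumnInjective f)
    (hdom : ∀ r, (Finset.univ.filter fun i => t.rowOf i < r).card ≤
      (Finset.univ.filter fun i => f i < r).card) :
    ∃ π ∈ t.colStabilizer, ∀ i, f i = t.rowOf (π i) := by
  classical
  -- Distinct letters below `r` in column `c` number at most min(r, λ'_c), a bound that the row word
  -- attains.
  have hle : ∀ r c, (Finset.univ.filter fun i => f i < r ∧ t.colOf i = c).card ≤
      (Finset.univ.filter fun i => t.rowOf i < r ∧ t.colOf i = c).card := by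
    intro r c
    by_cases hr : r ≤ μ.colLen c
    · have hex : ∀ i, f i < r → ∃ j, t.rowOf j = f i ∧ t.colOf j = c := fun i hi =>
        t.exists_box (hi.trans_le hr)
      choose! φ hφ using hex
      refine Finset.card_le_card_of_injOn φ (fun i hi => ?_) fun i hi j hj hij => ?_
      · simp only [Finset.coe_filter, Finset.mem_univ, true_and, Set.mem_ofPred_eq] at hi ⊢
        rw [(hφ i hi.1).1]
        exact ⟨hi.1, (hφ i hi.1).2⟩
      · simp only [Finset.coe_filter, Finset.mem_univ, true_and, Set.mem_ofPred_eq] at hi hj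
        refine hf i j (hi.2.trans hj.2.symm) ?_
        rw [← (hφ i hi.1).1, hij, (hφ j hj.1).1]
    · refine Finset.card_le_card fun i hi => ?_
      simp only [Finset.mem_filter, Finset.mem_univ, true_and] at hi ⊢
      have := t.rowOf_lt i
      rw [hi.2] at this
      exact ⟨by omega, hi.2⟩
  -- Summed over the columns, dominance turns these bounds into equalities. For r the length of the
  -- column of `i`, every letter of that column is then below r.
  have hlt : ∀ i, f i < μ.colLen (t.colOf i) := by
    intro i
    set r := μ.colLen (t.colOf i) with hr
    have hcard : ∀ F : Fin n → ℕ, (Finset.univ.filter fun i => F i < r).card =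
        ∑ c ∈ Finset.univ.image t.colOf,
          (Finset.univ.filter fun i => F i < r ∧ t.colOf i = c).card := fun F => by
      rw [Finset.card_eq_sum_card_fiberwise (f := t.colOf) (t := Finset.univ.image t.colOf)
        fun i _ => by simp]
      simp_rw [Finset.filter_filter]
    have hsum := hdom r
    rw [hcard, hcard] at hsum
    have heq := (Finset.sum_eq_sum_iff_of_le fun c _ => hle r c).1
      (le_antisymm (Finset.sum_le_sum fun c _ => hle r c) hsum) (t.colOf i)
      (Finset.mem_image_of_mem _ (Finset.mem_univ i))
    have hsub : (Finset.univ.filter fun j => f j < r ∧ t.colOf j = t.colOf i) ⊆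
        Finset.univ.filter fun j => t.rowOf j < r ∧ t.colOf j = t.colOf i := by
      intro j hj
      simp only [Finset.mem_filter, Finset.mem_univ, true_and] at hj ⊢
      have := t.rowOf_lt j
      rw [hj.2] at this
      exact ⟨this, hj.2⟩
    have hmem : i ∈ Finset.univ.filter fun j => t.rowOf j < r ∧ t.colOf j = t.colOf i := by
      simpa using t.rowOf_lt i
    rw [← Finset.eq_of_subset_of_card_le hsub heq.ge] at hmem
    exact (Finset.mem_filter.1 hmem).2.1
  choose φ hφ using fun i => t.exists_box (hlt i)
  have hinj : Function.Injective φ := fun i j hij => by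
    refine hf i j ?_ ?_
    · rw [← (hφ i).2, hij, (hφ j).2]
    · rw [← (hφ i).1, hij, (hφ j).1]
  exact ⟨Equiv.ofBijective φ (Finite.injective_iff_bijective.1 hinj),
    t.mem_colStabilizer.2 fun i => (hφ i).2, fun i => (hφ i).1.symm⟩

end ColumnCombinatorics

/-! ### The column antisymmetrizer. -/

section Antisymmetrizer

variable {μ : YoungDiagram} {n : ℕ} (t : Tableau μ n)
variable {V W : Type*} [AddCommGroup V] [Module ℂ V] [AddCommGroup W] [Module ℂ W]

/-- The signed sum of the elements of the column stabilizer, as an operator. -/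
noncomputable def Tableau.antisymmetrizer (ρ : Representation ℂ (Perm (Fin n)) V) : V →ₗ[ℂ] V :=
  ∑ π ∈ t.colStabilizer, ((Perm.sign π : ℤ) : ℂ) • ρ π

theorem Tableau.antisymmetrizer_apply (ρ : Representation ℂ (Perm (Fin n)) V) (v : V) :
    t.antisymmetrizer ρ v = ∑ π ∈ t.colStabilizer, ((Perm.sign π : ℤ) : ℂ) • ρ π v := by
  simp [Tableau.antisymmetrizer]

theorem Tableau.antisymmetrizer_apply_apply (ρ : Representation ℂ (Perm (Fin n)) V)
    {π : Perm (Fin n)} (hπ : π ∈ t.colStabilizer) (v : V) :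
    t.antisymmetrizer ρ (ρ π v) = ((Perm.sign π : ℤ) : ℂ) • t.antisymmetrizer ρ v := by
  rw [t.mem_colStabilizer] at hπ
  rw [t.antisymmetrizer_apply, t.antisymmetrizer_apply, Finset.smul_sum]
  refine Finset.sum_bij' (fun τ _ => τ * π) (fun τ _ => τ * π⁻¹) ?_ ?_ ?_ ?_ ?_
  · intro τ hτ
    rw [t.mem_colStabilizer] at hτ ⊢
    intro i
    rw [Perm.mul_apply, hτ, hπ]
  · intro τ hτ
    rw [t.mem_colStabilizer] at hτ ⊢
    intro i
    rw [Perm.mul_apply, hτ, ← hπ, Perm.inv_def, Equiv.apply_symm_apply]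
  · intro τ _
    group
  · intro τ _
    group
  · intro τ _
    rw [map_mul ρ, Module.End.mul_apply, smul_smul, Perm.sign_mul, mul_comm (Perm.sign τ)]
    push_cast
    rw [← mul_assoc, ← Int.cast_mul, ← Units.val_mul, Int.units_mul_self]
    simp

theorem Tableau.antisymmetrizer_antisymmetrizer (ρ : Representation ℂ (Perm (Fin n)) V) (v : V) :
    t.antisymmetrizer ρ (t.antisymmetrizer ρ v) =
      (t.colStabilizer.card : ℂ) • t.antisymmetrizer ρ v := by
  conv_lhs => rw [t.antisymmetrizer_apply ρ v, map_sum]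
  rw [Finset.sum_congr rfl (g := fun _ => t.antisymmetrizer ρ v) fun π hπ => ?_, Finset.sum_const,
    Nat.cast_smul_eq_nsmul]
  rw [map_smul, t.antisymmetrizer_apply_apply ρ hπ, smul_smul, ← Int.cast_mul, ← Units.val_mul,
    Int.units_mul_self]
  simp

theorem Tableau.card_colStabilizer_ne_zero : (t.colStabilizer.card : ℂ) ≠ 0 := by
  have h : (1 : Perm (Fin n)) ∈ t.colStabilizer := t.mem_colStabilizer.2 fun _ => rfl
  exact_mod_cast (Finset.card_pos.2 ⟨_, h⟩).ne'

theorem Tableau.map_antisymmetrizer {ρ : Representation ℂ (Perm (Fin n)) V}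
    {σ : Representation ℂ (Perm (Fin n)) W} (φ : Representation.IntertwiningMap ρ σ) (v : V) :
    φ (t.antisymmetrizer ρ v) = t.antisymmetrizer σ (φ v) := by
  rw [t.antisymmetrizer_apply, t.antisymmetrizer_apply, map_sum]
  refine Finset.sum_congr rfl fun π _ => ?_
  rw [map_smul, φ.isIntertwining]

theorem Tableau.antisymmetrizer_mem {ρ : Representation ℂ (Perm (Fin n)) V}
    (U : Subrepresentation ρ) {v : V} (hv : v ∈ U.toSubmodule) :
    t.antisymmetrizer ρ v ∈ U.toSubmodule := by
  rw [t.antisymmetrizer_apply]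
  exact Submodule.sum_mem _ fun π _ => Submodule.smul_mem _ _ (U.apply_mem_toSubmodule π hv)

theorem Tableau.polytabloid_eq :
    t.polytabloid = t.antisymmetrizer (Representation.ofMulAction ℂ (Perm (Fin n)) (Tabloid μ n))
      (MonoidAlgebra.single t.tabloid 1) := by
  rw [t.antisymmetrizer_apply, Tableau.polytabloid]
  refine Finset.sum_congr rfl fun π _ => ?_
  rw [Representation.ofMulAction_single, MonoidAlgebra.smul_single, smul_eq_mul, mul_one]

theorem Tableau.antisymmetrizer_polytabloid :
    t.antisymmetrizer (Representation.ofMulAction ℂ (Perm (Fin n)) (Tabloid μ n)) t.polytabloid =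
      (t.colStabilizer.card : ℂ) • t.polytabloid := by
  rw [t.polytabloid_eq, t.antisymmetrizer_antisymmetrizer]

/-- Swapping two equal letters of one column fixes the word but negates its antisymmetrization. The
set `X` is abstract so that this covers both tabloids and the words in Frobenius' formula. -/
theorem Tableau.antisymmetrizer_single_eq_zero {X : Type*} [MulAction (Perm (Fin n)) X]
    (word : X → Fin n → ℕ) (hinj : Function.Injective word)
    (hsmul : ∀ (g : Perm (Fin n)) x i, word (g • x) i = word x (g⁻¹ i)) {x : X}
    (hx : ¬ t.ColumnInjective (word x)) :
    t.antisymmetrizer (Representation.ofMulAction ℂ (Perm (Fin n)) X)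
      (MonoidAlgebra.single x 1) = 0 := by
  simp only [Tableau.ColumnInjective, not_forall] at hx
  obtain ⟨i, j, hc, hw, hij⟩ := hx
  have hmem : swap i j ∈ t.colStabilizer := t.mem_colStabilizer.2 fun k => by
    rcases eq_or_ne k i with rfl | hki
    · rw [swap_apply_left, hc]
    rcases eq_or_ne k j with rfl | hkj
    · rw [swap_apply_right, hc]
    rw [swap_apply_of_ne_of_ne hki hkj]
  have hfix : swap i j • x = x := hinj <| funext fun k => by
    rw [hsmul, swap_inv]
    rcases eq_or_ne k i with rfl | hki
    · rw [swap_apply_left, hw]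
    rcases eq_or_ne k j with rfl | hkj
    · rw [swap_apply_right, hw]
    rw [swap_apply_of_ne_of_ne hki hkj]
  have h := t.antisymmetrizer_apply_apply (Representation.ofMulAction ℂ (Perm (Fin n)) X) hmem
    (MonoidAlgebra.single x 1)
  rw [Representation.ofMulAction_single, hfix, Perm.sign_swap hij] at h
  rw [Units.val_neg, Units.val_one, Int.cast_neg, Int.cast_one, neg_one_smul] at h
  rw [← add_eq_zero_iff_eq_neg, ← two_smul ℂ] at h
  exact (smul_eq_zero.1 h).resolve_left two_ne_zero

end Antisymmetrizer

/-! ### Irreducibility of Specht modules and their maps to permutation modules. -/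

section Specht

variable {μ : YoungDiagram} {n : ℕ} (t : Tableau μ n)

theorem Tabloid.lt_colLen (T : Tabloid μ n) (i : Fin n) : T.1 i < μ.colLen 0 := by
  by_contra h
  have h1 := T.2 (T.1 i)
  rw [rowLen_eq_zero μ (not_lt.1 h), Nat.card_eq_zero] at h1
  rcases h1 with h1 | h1
  · exact h1.elim ⟨i, rfl⟩
  · exact h1.not_finite inferInstance

instance : Finite (Tabloid μ n) :=
  Finite.of_injective (β := Fin n → Fin (μ.colLen 0)) (fun T i => ⟨T.1 i, T.lt_colLen i⟩)
    fun _ _ h => Subtype.ext (funext fun i => congrArg Fin.val (congrFun h i))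

theorem Tabloid.word_smul (g : Perm (Fin n)) (T : Tabloid μ n) (i : Fin n) :
    (g • T).1 i = T.1 (g⁻¹ i) := rfl

theorem Tableau.tabloid_val (i : Fin n) : t.tabloid.1 i = t.rowOf i := rfl

theorem card_filter_lt_eq_sum (f : Fin n → ℕ) (r : ℕ) :
    (Finset.univ.filter fun i => f i < r).card = ∑ s ∈ Finset.range r, Nat.card {i // f i = s} := by
  rw [Finset.card_eq_sum_card_fiberwise (f := f) (t := Finset.range r) fun i hi => by simpa using hi]
  refine Finset.sum_congr rfl fun s hs => ?_
  rw [Nat.card_eq_fintype_card, Fintype.card_subtype, Finset.filter_filter]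
  congr 1
  ext i
  simp only [Finset.mem_filter, Finset.mem_univ, true_and, and_iff_right_iff_imp]
  rintro rfl
  exact Finset.mem_range.1 hs

/-- A tabloid either repeats a letter in some column of `t` and is killed, or is a column
permutation of {t} and goes to ± e_t. -/
theorem Tableau.antisymmetrizer_mem_span (v : MonoidAlgebra ℂ (Tabloid μ n)) :
    t.antisymmetrizer (Representation.ofMulAction ℂ (Perm (Fin n)) (Tabloid μ n)) v ∈
      Submodule.span ℂ {t.polytabloid} := by
  induction v using MonoidAlgebra.induction_linear with
  | zero => rw [map_zero]; exact Submodule.zero_mem _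
  | add v w hv hw => rw [map_add]; exact Submodule.add_mem _ hv hw
  | single T a =>
    rw [← mul_one a, ← smul_eq_mul, ← MonoidAlgebra.smul_single, map_smul]
    refine Submodule.smul_mem _ _ ?_
    by_cases hT : t.ColumnInjective T.1
    · obtain ⟨π, hπ, h⟩ := hT.exists_eq_rowOf t fun r => by
        refine le_of_eq ?_
        rw [card_filter_lt_eq_sum, card_filter_lt_eq_sum]
        exact Finset.sum_congr rfl fun s _ => (t.tabloid.2 s).trans (T.2 s).symm
      have hπ' : π⁻¹ ∈ t.colStabilizer := by
        rw [t.mem_colStabilizer] at hπ ⊢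
        intro i
        rw [← hπ, Perm.inv_def, Equiv.apply_symm_apply]
      have hTt : T = π⁻¹ • t.tabloid := Subtype.ext <| funext fun i => by
        rw [Tabloid.word_smul, inv_inv, t.tabloid_val, h]
      rw [hTt, ← Representation.ofMulAction_single, t.antisymmetrizer_apply_apply _ hπ',
        ← t.polytabloid_eq]
      exact Submodule.smul_mem _ _ (Submodule.mem_span_singleton_self _)
    · rw [t.antisymmetrizer_single_eq_zero (fun T : Tabloid μ n => T.1) Subtype.val_injective
        (fun _ _ _ => rfl) hT]
      exact Submodule.zero_mem _

theorem Tableau.polytabloid_ne_zero : t.polytabloid ≠ 0 := by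
  classical
  intro h
  have h1 := congrArg (fun v => v.coeff t.tabloid) h
  simp only [Tableau.polytabloid, MonoidAlgebra.coeff_sum, MonoidAlgebra.coeff_single,
    Finsupp.finsetSum_apply, MonoidAlgebra.coeff_zero, Finsupp.coe_zero, Pi.zero_apply] at h1
  -- Only the identity preserves both the rows and the columns of `t`, so {t} has coefficient 1.
  rw [Finset.sum_eq_single 1] at h1
  · simp at h1
  · intro π hπ hne
    rw [Finsupp.single_apply, if_neg]
    intro heq
    refine hne (Equiv.ext fun i => ?_)
    have h2 := congrFun (congrArg Subtype.val heq) (π i)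
    rw [Tabloid.word_smul, Perm.inv_def, Equiv.symm_apply_apply] at h2
    exact t.ext_box h2.symm (t.mem_colStabilizer.1 hπ i)
  · intro h
    exact absurd (t.mem_colStabilizer.2 fun _ => rfl) h

theorem Tableau.polytabloid_mem : t.polytabloid ∈ (spechtSubrep μ n).toSubmodule :=
  Submodule.subset_span ⟨t, rfl⟩

theorem Tableau.exists_apply_eq_polytabloid (t' : Tableau μ n) : ∃ g : Perm (Fin n),
    Representation.ofMulAction ℂ (Perm (Fin n)) (Tabloid μ n) g t.polytabloid = t'.polytabloid := by
  refine ⟨t.trans t'.symm, ?_⟩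
  rw [ofMulAction_polytabloid]
  congr 1
  ext1 i
  simp [Perm.inv_def]

theorem Tableau.specht_le {U : Subrepresentation
    (Representation.ofMulAction ℂ (Perm (Fin n)) (Tabloid μ n))}
    (h : t.polytabloid ∈ U.toSubmodule) : spechtSubrep μ n ≤ U := by
  have h' : Submodule.span ℂ (Set.range Tableau.polytabloid) ≤ U.toSubmodule := by
    rw [Submodule.span_le]
    rintro _ ⟨t', rfl⟩
    obtain ⟨g, hg⟩ := t.exists_apply_eq_polytabloid t'
    rw [← hg]
    exact U.apply_mem_toSubmodule g h
  exact h'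

/-- The antisymmetrizer kills a proper subrepresentation U, since otherwise e_t ∈ U. Applied to e_t
= u + u' along a Maschke complement U', it gives e_t ∈ U'. Hence U ≤ V_λ ≤ U' and U = 0. -/
theorem Tableau.isAtom_spechtSubrep (t : Tableau μ n) : IsAtom (spechtSubrep μ n) := by
  have : NeZero (Nat.card (Perm (Fin n)) : ℂ) := ⟨by exact_mod_cast Nat.card_pos.ne'⟩
  refine ⟨fun h => t.polytabloid_ne_zero ?_, fun U hU => ?_⟩
  · have hmem := t.polytabloid_mem
    rw [h] at hmem
    exact (Submodule.mem_bot ℂ).1 hmem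
  · obtain ⟨U', hU'⟩ := exists_isCompl U
    have hker : ∀ u ∈ U.toSubmodule, t.antisymmetrizer
        (Representation.ofMulAction ℂ (Perm (Fin n)) (Tabloid μ n)) u = 0 := by
      intro u hu
      obtain ⟨a, ha⟩ := Submodule.mem_span_singleton.1 (t.antisymmetrizer_mem_span u)
      rw [← ha]
      rcases eq_or_ne a 0 with rfl | ha0
      · exact zero_smul _ _
      · have hmem := t.antisymmetrizer_mem U hu
        rw [← ha, Submodule.smul_mem_iff _ ha0] at hmem
        exact absurd (t.specht_le hmem) (not_le_of_gt hU)
    have htop : t.polytabloid ∈ (U ⊔ U').toSubmodule := by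
      rw [hU'.sup_eq_top]
      exact Submodule.mem_top
    rw [Subrepresentation.toSubmodule_sup] at htop
    obtain ⟨u, hu, u', hu', hsum⟩ := Submodule.mem_sup.1 htop
    have hmem : t.polytabloid ∈ U'.toSubmodule := by
      rw [← Submodule.smul_mem_iff _ t.card_colStabilizer_ne_zero, ← t.antisymmetrizer_polytabloid,
        ← hsum, map_add, hker u hu, zero_add]
      exact t.antisymmetrizer_mem U' hu'
    exact le_bot_iff.1 (hU'.inf_eq_bot ▸ le_inf le_rfl (hU.le.trans (t.specht_le hmem)))

theorem Tableau.isIrreducible_spechtRep (t : Tableau μ n) : (spechtRep μ n).IsIrreducible :=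
  isIrreducible_of_isAtom t.isAtom_spechtSubrep

/-- The polytabloid of `t` as an element of the Specht module. -/
noncomputable def Tableau.spechtVector : (spechtSubrep μ n).toSubmodule :=
  ⟨t.polytabloid, t.polytabloid_mem⟩

theorem Tableau.antisymmetrizer_spechtVector :
    t.antisymmetrizer (spechtRep μ n) t.spechtVector =
      (t.colStabilizer.card : ℂ) • t.spechtVector := by
  refine Subtype.ext ?_
  rw [Submodule.coe_smul]
  refine Eq.trans ?_ t.antisymmetrizer_polytabloid
  rw [t.antisymmetrizer_apply, t.antisymmetrizer_apply, AddSubmonoidClass.coe_finsetSum]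
  rfl

/-- The difference kills a nonzero vector of an irreducible representation, so it is zero. Hom
spaces are thus determined by the image of e_t, which is itself antisymmetrized. -/
theorem Tableau.intertwiningMap_ext {V : Type*} [AddCommGroup V] [Module ℂ V]
    {σ : Representation ℂ (Perm (Fin n)) V} {φ ψ : (spechtRep μ n).IntertwiningMap σ}
    (h : φ t.spechtVector = ψ t.spechtVector) : φ = ψ := by
  have := t.isIrreducible_spechtRep
  rw [← sub_eq_zero]
  refine (Representation.IsIrreducible.injective_or_eq_zero (φ - ψ)).resolve_left fun hinj => ?_
  have h0 : t.spechtVector = 0 := hinj <| by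
    rw [map_zero, Representation.IntertwiningMap.coe_sub, Pi.sub_apply, h, sub_self]
  exact t.polytabloid_ne_zero (congrArg Subtype.val h0)

theorem Tableau.map_spechtVector {V : Type*} [AddCommGroup V] [Module ℂ V]
    {σ : Representation ℂ (Perm (Fin n)) V} (φ : (spechtRep μ n).IntertwiningMap σ) :
    φ t.spechtVector =
      (t.colStabilizer.card : ℂ)⁻¹ • t.antisymmetrizer σ (φ t.spechtVector) := by
  rw [← t.map_antisymmetrizer, t.antisymmetrizer_spechtVector, map_smul, smul_smul,
    inv_mul_cancel₀ t.card_colStabilizer_ne_zero, one_smul]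

theorem Tableau.finrank_intertwiningMap_eq_zero {X : Type*} [MulAction (Perm (Fin n)) X]
    (word : X → Fin n → ℕ) (hinj : Function.Injective word)
    (hsmul : ∀ (g : Perm (Fin n)) x i, word (g • x) i = word x (g⁻¹ i))
    (hX : ∀ x, ¬ t.ColumnInjective (word x)) :
    Module.finrank ℂ ((spechtRep μ n).IntertwiningMap
      (Representation.ofMulAction ℂ (Perm (Fin n)) X)) = 0 := by
  have hzero : t.antisymmetrizer (Representation.ofMulAction ℂ (Perm (Fin n)) X) = 0 := by
    refine LinearMap.ext fun v => ?_
    induction v using MonoidAlgebra.induction_linear with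
    | zero => simp
    | add v w hv hw => rw [map_add, hv, hw]; simp
    | single x a =>
      rw [← mul_one a, ← smul_eq_mul, ← MonoidAlgebra.smul_single, map_smul,
        t.antisymmetrizer_single_eq_zero word hinj hsmul (hX x)]
      simp
  have : Subsingleton ((spechtRep μ n).IntertwiningMap
      (Representation.ofMulAction ℂ (Perm (Fin n)) X)) := ⟨fun φ ψ => t.intertwiningMap_ext <| by
    rw [t.map_spechtVector φ, t.map_spechtVector ψ, hzero]
    simp⟩
  exact Module.finrank_zero_of_subsingleton

theorem Tableau.finrank_intertwiningMap_tabloid (t : Tableau μ n) :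
    Module.finrank ℂ ((spechtRep μ n).IntertwiningMap
      (Representation.ofMulAction ℂ (Perm (Fin n)) (Tabloid μ n))) = 1 := by
  let ι : (spechtRep μ n).IntertwiningMap
      (Representation.ofMulAction ℂ (Perm (Fin n)) (Tabloid μ n)) :=
    ⟨(spechtSubrep μ n).toSubmodule.subtype, fun _ => rfl⟩
  have hι : ι t.spechtVector = t.polytabloid := rfl
  refine finrank_eq_one ι (fun h => t.polytabloid_ne_zero ?_) fun φ => ?_
  · rw [← hι, h]
    rfl
  · obtain ⟨a, ha⟩ := Submodule.mem_span_singleton.1 (t.antisymmetrizer_mem_span (φ t.spechtVector))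
    refine ⟨(t.colStabilizer.card : ℂ)⁻¹ * a, t.intertwiningMap_ext ?_⟩
    rw [Representation.IntertwiningMap.smul_apply, hι, t.map_spechtVector φ, ← ha, smul_smul]

end Specht

/-! ### Frobenius' formula for the Specht character. -/

section FrobeniusFormula

variable {μ : YoungDiagram} {n N : ℕ}

/-- The words counted by the term of `w` in `frobeniusChar l`. -/
def ShiftedWord (n : ℕ) (l : Fin N → ℕ) (w : Perm (Fin N)) : Type :=
  {f : Fin n → Fin N // ∀ r, content f r + staircase N (w r) = l r}

instance (l : Fin N → ℕ) (w : Perm (Fin N)) : Finite (ShiftedWord n l w) :=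
  inferInstanceAs (Finite {f : Fin n → Fin N // ∀ r, content f r + staircase N (w r) = l r})

theorem content_comp_perm (f : Fin n → Fin N) (g : Perm (Fin n)) :
    content (fun i => f (g i)) = content f :=
  Finsupp.ext fun r => by
    rw [content_apply, content_apply]
    exact Fintype.card_congr (g.subtypeEquiv fun _ => Iff.rfl)

instance (l : Fin N → ℕ) (w : Perm (Fin N)) : MulAction (Perm (Fin n)) (ShiftedWord n l w) where
  smul g f := ⟨fun i => f.1 (g⁻¹ i), fun r => by rw [content_comp_perm]; exact f.2 r⟩
  one_smul _ := rfl
  mul_smul g h f := Subtype.ext <| funext fun i => by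
    change f.1 ((g * h)⁻¹ i) = f.1 (h⁻¹ (g⁻¹ i))
    rw [mul_inv_rev, Perm.mul_apply]

theorem comp_inv_eq_iff {α : Type*} (f : Fin n → α) (g : Perm (Fin n)) :
    (fun i => f (g⁻¹ i)) = f ↔ f ∘ g = f := by
  constructor
  · intro h
    funext i
    have := congrFun h (g i)
    simpa using this.symm
  · intro h
    funext i
    have := congrFun h (g⁻¹ i)
    simpa using this.symm

theorem card_fixed_shiftedWord (l : Fin N → ℕ) (w : Perm (Fin N)) (g : Perm (Fin n)) :
    Nat.card {f : ShiftedWord n l w // g • f = f} = (Finset.univ.filter fun f : Fin n → Fin N =>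
      f ∘ g = f ∧ ∀ r, content f r + staircase N (w r) = l r).card := by
  rw [← Fintype.card_subtype, ← Nat.card_eq_fintype_card]
  exact Nat.card_congr
    { toFun := fun f => ⟨f.1.1, (comp_inv_eq_iff _ g).1 (congrArg Subtype.val f.2), f.1.2⟩
      invFun := fun f => ⟨⟨f.1, f.2.2⟩, Subtype.ext ((comp_inv_eq_iff _ g).2 f.2.1)⟩
      left_inv := fun _ => rfl
      right_inv := fun _ => rfl }

theorem frobeniusChar_eq_sum_character (l : Fin N →₀ ℕ) (g : Perm (Fin n)) :
    (frobeniusChar l g : ℂ) = ∑ w : Perm (Fin N), ((Perm.sign w : ℤ) : ℂ) *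
      (Representation.ofMulAction ℂ (Perm (Fin n)) (ShiftedWord n l w)).character g := by
  rw [frobeniusChar, Int.cast_sum]
  refine Finset.sum_congr rfl fun w _ => ?_
  rw [character_ofMulAction, card_fixed_shiftedWord, Int.cast_mul, Int.cast_natCast]

theorem card_val_eq_content (f : Fin n → Fin N) (r : Fin N) :
    Nat.card {i // (f i : ℕ) = r} = content f r := by
  rw [content_apply, ← Nat.card_eq_fintype_card]
  exact Nat.card_congr (Equiv.subtypeEquivRight fun i => Fin.ext_iff.symm)

theorem sum_range_id_le_sum (A : Finset ℕ) : ∑ s ∈ Finset.range A.card, s ≤ ∑ s ∈ A, s := by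
  induction A using Finset.induction_on_max with
  | empty => simp
  | insert a A hA ih =>
    have ha : a ∉ A := fun h => lt_irrefl _ (hA a h)
    rw [Finset.card_insert_of_notMem ha, Finset.sum_range_succ, Finset.sum_insert ha, add_comm]
    refine add_le_add ?_ ih
    have : A ⊆ Finset.range a := fun b hb => Finset.mem_range.2 (hA b hb)
    simpa using Finset.card_le_card this

theorem sum_staircase_comp_le (w : Perm (Fin N)) {r : ℕ} (hr : r ≤ N) :
    ∑ s : Fin r, staircase N (w (Fin.castLE hr s)) ≤ ∑ s : Fin r, staircase N (Fin.castLE hr s) := by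
  have hinj : Function.Injective fun s : Fin r => (w (Fin.castLE hr s) : ℕ) := fun s s' h =>
    Fin.castLE_injective hr (w.injective (Fin.ext h))
  have h1 := sum_range_id_le_sum (Finset.univ.image fun s : Fin r => (w (Fin.castLE hr s) : ℕ))
  rw [Finset.card_image_of_injective _ hinj, Finset.sum_image hinj.injOn, Finset.card_univ,
    Fintype.card_fin, ← Fin.sum_univ_eq_sum_range (fun s => s)] at h1
  have h2 : ∀ v : Fin r → Fin N, ∑ s, staircase N (v s) + ∑ s, (v s : ℕ) = ∑ _s : Fin r, (N - 1) :=
    fun v => by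
      rw [← Finset.sum_add_distrib]
      refine Finset.sum_congr rfl fun s _ => ?_
      have := staircase_add (v s)
      omega
  have h3 := h2 fun s => w (Fin.castLE hr s)
  have h4 := h2 fun s => Fin.castLE hr s
  simp only [Fin.val_castLE] at h4
  omega

/-- The word has content l - δ∘w. As δ is decreasing, the partial sums of δ∘w are at most those of
δ, so this content dominates λ. Column injectivity then forces content λ, that is δ∘w = δ. -/
theorem eq_one_of_columnInjective (t : Tableau μ n) {w : Perm (Fin N)}
    (f : ShiftedWord n (shiftedParts μ N) w) (hf : t.ColumnInjective fun i => (f.1 i : ℕ)) :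
    w = 1 := by
  have hrow : ∀ s, Nat.card {i // t.rowOf i = s} = μ.rowLen s := t.tabloid.2
  have hdom : ∀ r, (Finset.univ.filter fun i => t.rowOf i < r).card ≤
      (Finset.univ.filter fun i => (f.1 i : ℕ) < r).card := by
    intro r
    rcases le_total r N with hr | hr
    · rw [card_filter_lt_eq_sum, card_filter_lt_eq_sum]
      simp_rw [hrow]
      rw [← Fin.sum_univ_eq_sum_range, ← Fin.sum_univ_eq_sum_range
        (fun s => Nat.card {i // (f.1 i : ℕ) = s})]
      have h1 := sum_staircase_comp_le w hr
      have h2 : ∑ s : Fin r, (Nat.card {i // (f.1 i : ℕ) = s} +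
          staircase N (w (Fin.castLE hr s))) =
          ∑ s : Fin r, (μ.rowLen s + staircase N (Fin.castLE hr s)) :=
        Finset.sum_congr rfl fun s _ => by
          rw [← Fin.val_castLE hr s, card_val_eq_content, f.2 (Fin.castLE hr s)]
          rfl
      rw [Finset.sum_add_distrib, Finset.sum_add_distrib] at h2
      omega
    · refine Finset.card_le_card fun i _ => ?_
      simpa using (f.1 i).2.trans_le hr
  obtain ⟨π, -, hπ⟩ := hf.exists_eq_rowOf t hdom
  refine Equiv.ext fun s => strictAnti_staircase.injective ?_
  have h1 : Nat.card {i // (f.1 i : ℕ) = s} = μ.rowLen s := by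
    rw [← hrow]
    exact Nat.card_congr (π.subtypeEquiv fun i => by rw [hπ])
  have h2 := f.2 s
  rw [← card_val_eq_content, h1, shiftedParts_apply] at h2
  exact Nat.add_left_cancel h2

theorem character_shiftedWord_one (hN : μ.colLen 0 ≤ N) (g : Perm (Fin n)) :
    (Representation.ofMulAction ℂ (Perm (Fin n))
      (ShiftedWord n (shiftedParts μ N) 1)).character g =
    (Representation.ofMulAction ℂ (Perm (Fin n)) (Tabloid μ n)).character g := by
  rw [character_ofMulAction, character_ofMulAction]
  have hrow : ∀ (f : ShiftedWord n (shiftedParts μ N) 1) r,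
      Nat.card {i // (f.1 i : ℕ) = r} = μ.rowLen r := by
    intro f r
    by_cases hr : r < N
    · have h := f.2 ⟨r, hr⟩
      rw [← card_val_eq_content] at h
      exact Nat.add_right_cancel h
    · rw [rowLen_eq_zero μ (hN.trans (not_lt.1 hr))]
      have : IsEmpty {i // (f.1 i : ℕ) = r} := ⟨fun i => hr (i.2 ▸ (f.1 i.1).2)⟩
      exact Nat.card_of_isEmpty
  have hlt : ∀ (T : Tabloid μ n) i, T.1 i < N := fun T i => (T.lt_colLen i).trans_le hN
  congr 1
  exact Nat.card_congr
    { toFun := fun f => ⟨⟨fun i => f.1.1 i, hrow f.1⟩,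
        Subtype.ext (funext fun i => congrArg Fin.val (congrFun (congrArg Subtype.val f.2) i))⟩
      invFun := fun T => ⟨⟨fun i => ⟨T.1.1 i, hlt T.1 i⟩, fun r => by
          rw [← card_val_eq_content, shiftedParts_apply, ← T.1.2 r]
          rfl⟩,
        Subtype.ext (funext fun i => Fin.ext (congrFun (congrArg Subtype.val T.2) i))⟩
      left_inv := fun _ => rfl
      right_inv := fun _ => rfl }

/-- Inner products with permutation characters are dimensions of Hom spaces: 1 for w = 1 and 0 for
every other w. -/
theorem sum_frobeniusChar_mul_character (t : Tableau μ n) (hN : μ.colLen 0 ≤ N) :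
    ∑ g : Perm (Fin n), (frobeniusChar (shiftedParts μ N) g : ℂ) *
      (spechtRep μ n).character g⁻¹ = n.factorial := by
  have hG : (Nat.card (Perm (Fin n)) : ℂ) ≠ 0 := by exact_mod_cast Nat.card_pos.ne'
  have : Invertible (Nat.card (Perm (Fin n)) : ℂ) := invertibleOfNonzero hG
  have key : ∀ w : Perm (Fin N), ∑ g : Perm (Fin n), (Representation.ofMulAction ℂ (Perm (Fin n))
      (ShiftedWord n (shiftedParts μ N) w)).character g * (spechtRep μ n).character g⁻¹ =
      if w = 1 then (n.factorial : ℂ) else 0 := by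
    intro w
    split_ifs with hw
    · subst hw
      have h := Representation.card_inv_mul_sum_char_mul_char_eq_finrank (spechtRep μ n)
        (Representation.ofMulAction ℂ (Perm (Fin n)) (Tabloid μ n))
      rw [t.finrank_intertwiningMap_tabloid, inv_mul_eq_iff_eq_mul₀ hG, Nat.cast_one, mul_one] at h
      simp_rw [character_shiftedWord_one hN]
      rw [h, Nat.card_eq_fintype_card, Fintype.card_perm, Fintype.card_fin]
    · have h := Representation.card_inv_mul_sum_char_mul_char_eq_finrank (spechtRep μ n)
        (Representation.ofMulAction ℂ (Perm (Fin n)) (ShiftedWord n (shiftedParts μ N) w))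
      rwa [t.finrank_intertwiningMap_eq_zero (fun (f : ShiftedWord n (shiftedParts μ N) w) i => (f.1 i : ℕ))
        (fun f f' h => Subtype.ext (funext fun i => Fin.ext (congrFun h i))) (fun _ _ _ => rfl)
        fun f hf => hw (eq_one_of_columnInjective t f hf), inv_mul_eq_iff_eq_mul₀ hG,
        Nat.cast_zero, mul_zero] at h
  simp_rw [frobeniusChar_eq_sum_character, Finset.sum_mul]
  rw [Finset.sum_comm]
  simp_rw [mul_assoc, ← Finset.mul_sum, key]
  simp

/-- The character of the Specht module is given by Frobenius' formula. -/
theorem character_spechtRep (t : Tableau μ n) (hN : μ.colLen 0 ≤ N) (hμ : μ.card = n)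
    (g : Perm (Fin n)) :
    (spechtRep μ n).character g = frobeniusChar (shiftedParts μ N) g := by
  have hG : (Nat.card (Perm (Fin n)) : ℂ) ≠ 0 := by exact_mod_cast Nat.card_pos.ne'
  have : Invertible (Nat.card (Perm (Fin n)) : ℂ) := invertibleOfNonzero hG
  have hcard : (Nat.card (Perm (Fin n)) : ℂ) = n.factorial := by
    rw [Nat.card_eq_fintype_card, Fintype.card_perm, Fintype.card_fin]
  have h1 := sum_frobeniusChar_mul_character t hN
  have h2 : ∑ g : Perm (Fin n), (spechtRep μ n).character g * (spechtRep μ n).character g⁻¹ =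
      n.factorial := by
    have := t.isIrreducible_spechtRep
    have h := Representation.char_orthonormal (spechtRep μ n) (spechtRep μ n)
    rwa [if_pos ⟨Representation.Equiv.refl _⟩, inv_mul_eq_iff_eq_mul₀ hG, mul_one, hcard] at h
  have h3 : ∑ g : Perm (Fin n), (frobeniusChar (shiftedParts μ N) g : ℂ) ^ 2 = n.factorial := by
    exact_mod_cast sum_frobeniusChar_sq (shiftedParts μ N) (hμ ▸ sum_shiftedParts μ hN)
      (strictAnti_shiftedParts μ).injective
  have h1' := congrArg (starRingEnd ℂ) h1
  simp_rw [character_inv_eq_conj] at h1 h1' h2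
  simp only [map_sum, map_mul, Complex.conj_conj, map_intCast, map_natCast] at h1'
  -- The squared distance expands to n! (1 - 1 - 1 + 1), because `frobeniusChar` takes integer
  -- values.
  have h4 : ∑ g : Perm (Fin n), Complex.normSq
      ((spechtRep μ n).character g - frobeniusChar (shiftedParts μ N) g) = 0 := by
    have h5 : ((∑ g : Perm (Fin n), Complex.normSq
        ((spechtRep μ n).character g - frobeniusChar (shiftedParts μ N) g) : ℝ) : ℂ) = 0 := by
      rw [Complex.ofReal_sum]
      simp_rw [← Complex.mul_conj, map_sub, map_intCast]
      calc _ = ∑ g : Perm (Fin n), ((spechtRep μ n).character g *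
              (starRingEnd ℂ) ((spechtRep μ n).character g) -
            (frobeniusChar (shiftedParts μ N) g : ℂ) * (starRingEnd ℂ) ((spechtRep μ n).character g) -
            (frobeniusChar (shiftedParts μ N) g : ℂ) * (spechtRep μ n).character g +
            (frobeniusChar (shiftedParts μ N) g : ℂ) ^ 2) :=
              Finset.sum_congr rfl fun g _ => by ring
        _ = 0 := by
          rw [Finset.sum_add_distrib, Finset.sum_sub_distrib, Finset.sum_sub_distrib, h1, h1', h2, h3]
          ring
    exact_mod_cast h5
  have h6 := (Finset.sum_eq_zero_iff_of_nonneg fun g _ => Complex.normSq_nonneg _).1 h4 g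
    (Finset.mem_univ g)
  exact sub_eq_zero.1 (Complex.normSq_eq_zero.1 h6)

open PowerSeries in
-- A letter is read as the exponent of a variable. Exponents in degree `d` are at most `d`, so an
-- alphabet of `N > d` letters suffices.
theorem coeff_fixedWordSum_X_pow {d : ℕ} (hd : d < N) (g : Perm (Fin n)) :
    coeff d (fixedWordSum g fun j : Fin N => (X : ℂ⟦X⟧) ^ (j : ℕ)) =
      (homogeneousRep n d).character g := by
  rw [character_homogeneousRep, fixedWordSum, map_sum]
  simp_rw [Finset.prod_pow_eq_pow_sum, coeff_X_pow]
  rw [Finset.sum_boole, Finset.filter_filter, ← Fintype.card_subtype, ← Nat.card_eq_fintype_card]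
  congr 1
  refine Nat.card_congr
    { toFun := fun f => ⟨fun i => f.1 i, f.2.2.symm, funext fun i => congrArg Fin.val (congrFun f.2.1 i)⟩
      invFun := fun a => ⟨fun i => ⟨a.1 i, lt_of_le_of_lt ?_ hd⟩,
        funext fun i => Fin.ext (congrFun a.2.2 i), a.2.1.symm⟩
      left_inv := fun _ => rfl
      right_inv := fun _ => rfl }
  exact (Finset.single_le_sum (fun _ _ => Nat.zero_le _) (Finset.mem_univ i)).trans_eq a.2.1

end FrobeniusFormula

/-! ### The inner product of the two characters. -/

open PowerSeries in
theorem sum_character_homogeneousRep_mul {μ : YoungDiagram} {n : ℕ} (d : ℕ) (hμ : μ.card = n)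
    (box : Fin n ≃ μ.cells) :
    ∑ g : Perm (Fin n), (homogeneousRep n d).character g * (spechtRep μ n).character g⁻¹ =
      n.factorial * Set.ncard {y : Fin n → ℕ |
        ∑ i, (hookLength μ (box i) : ℤ) * (y i : ℤ) = (d : ℤ) - (nStat μ : ℤ)} := by
  -- Large enough both for the hook formula modulo q^{d+1} and for `d < N`, even when `μ` is empty.
  set N := μ.colLen 0 + d + 1 with hN
  have hinj : Function.Injective fun j : Fin N => (X : ℂ⟦X⟧) ^ (j : ℕ) := fun i j h => by
    have h' := congrArg (coeff (i : ℕ)) h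
    simp only [coeff_X_pow, if_true] at h'
    by_contra hne
    rw [if_neg fun h => hne (Fin.ext h)] at h'
    exact one_ne_zero h'
  have h := alternant_mul_sum_frobeniusChar (n := n) (shiftedParts μ N)
    (hμ ▸ sum_shiftedParts μ (by omega)) (fun j : Fin N => (X : ℂ⟦X⟧) ^ (j : ℕ)) hinj
  rw [← map_natCast (C (R := ℂ))] at h
  rw [← coeff_eq_ncard (d := d) μ (by omega) box _ _ h, map_sum]
  refine Finset.sum_congr rfl fun g _ => ?_
  rw [← map_intCast (C (R := ℂ)), coeff_C_mul, coeff_fixedWordSum_X_pow (by omega),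
    character_inv_eq_conj, character_spechtRep (N := N) box (by omega) hμ, map_intCast, mul_comm]

end SymMult

/-- `box` is any numbering of the boxes of `μ`, so that `hookLength μ (box i)` is the hook length of
the `i`-th box. -/
theorem mainTheorem1 (n d : ℕ) (μ : YoungDiagram) (hμ : μ.card = n) (box : Fin n ≃ μ.cells) :
    (SymMult.spechtRep μ n).IsIrreducible ∧
    SymMult.HasMultiplicity (SymMult.homogeneousRep n d) (SymMult.spechtRep μ n)
      (Set.ncard {y : Fin n → ℕ |
        ∑ i, (SymMult.hookLength μ (box i) : ℤ) * (y i : ℤ) = (d : ℤ) - (SymMult.nStat μ : ℤ)}) := by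
  have := SymMult.Tableau.isIrreducible_spechtRep box
  refine ⟨this, SymMult.hasMultiplicity_of_character ?_⟩
  rw [Fintype.card_perm, Fintype.card_fin]
  exact SymMult.sum_character_homogeneousRep_mul d hμ box
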